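/- Let $\Omega\subset\mathbb R^d$ ($d\ge1$) be open and bounded, let $\phi\in L^\infty(\Omega)$ with $\phi\ge\phi_*>0$ a.e., let $f=f(s,x,t)$ be measurable on $\mathbb R\times\Omega\times[0,T]$, Lipschitz continuous in $s$ uniformly in $(x,t)$, with $f(0,\cdot,\cdot)\in L^\infty(\Omega\times(0,T))$, and let $c_{\rm ini}\in L^\infty(\Omega)$. Consider a space-time gradient discretisation: a finite-dimensional real space $X$, linear reconstructions $\Pi:X\to L^\infty(\Omega)$, $\nabla_X:X\to L^\infty(\Omega)^d$, an interpolant $I:L^\infty(\Omega)\to X$, and times $0=t^{(0)}<\dots<t^{(N)}=T$; put $\delta_n=t^{(n+1)}-t^{(n)}$, and assume that $\Pi z_1=1$ a.e. for some $z_1\in X$. For $0\le n<N$ let $u^{(n+1)}\in L^2(\Omega)^d$ with distributional divergence $\operatorname{div}u^{(n+1)}\in L^\infty(\Omega)$ (a representative being fixed), and let $F_t=F^{(n+1)}_t:\Omega\to\Omega$, $t\in[-T,T]$, be a flow of $b=u^{(n+1)}/\phi$, that is: - for a.e. $x$, $s\mapsto b(F_s(x))$ is integrable on $[-T,T]$ and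 $F_t(x)=x+\int_0^t b(F_s(x))\,ds$ for all $t\in[-T,T]$; - $F_{s+t}=F_s\circ F_t$ a.e. on $\Omega$ whenever $s,t,s+t\in[-T,T]$; - a.e. $x\in\Omega$ has an open neighbourhood $V\subset\Omega$ such that, for all $t\in[-T,T]$, $F_t$ is a bi-Lipschitz bijection of $V$ onto the open set $F_t(V)$ with inverse $F_{-t}$, with Lipschitz constants independent of $t$. Let $\alpha\in L^\infty(\Omega)$ and $w\in[0,1]$. Let $c^{(0)}=I c_{\rm ini},c^{(1)},\dots,c^{(N)}\in X$ solve the ELLAM–MMOC scheme: for all $0\le n<N$ and $z\in X$, $$\begin{aligned} &\int_\Omega\phi\,\Pi c^{(n+1)}\,\Pi z-\int_\Omega\phi\,\alpha\,\Pi c^{(n)}\,(\Pi z)\circ F_{\delta_n}-\int_\Omega\phi\,\big[(1-\alpha)\Pi c^{(n)}\big]\circ F_{-\delta_n}\,\Pi z\\ &=\delta_n\int_\Omega\alpha\big(wf_n\,(\Pi z)\circ F_{\delta_n}+(1-w)f_{n+1}\Pi z\big)+\delta_n\int_\Omega(1-\alpha)\big(wf_n+(1-w)f_{n+1}\big)\Pi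 z\\ &\quad-\delta_n\int_\Omega(1-\alpha)\operatorname{div}u^{(n+1)}\big(w\Pi c^{(n)}+(1-w)\Pi c^{(n+1)}\big)\Pi z , \end{aligned}$$ where either $f$ is continuous in $t\in[0,T]$ and $f_k(x)=f(\Pi c^{(k)}(x),x,t^{(k)})$, or $f_k(x)$ is the average of $f(\Pi c^{(k)}(x),x,\cdot)$ over $(t^{(k)},t^{(k+1)})$ (over $(t^{(N-1)},t^{(N)})$ if $k=N$). For $0\le n<N$ let $$e_{\rm mass}=\Big|\int_\Omega\phi\,\Pi c^{(n+1)}-\int_\Omega\phi\,\Pi c^{(n)}-\delta_n\int_\Omega\big(wf_n+(1-w)f_{n+1}\big)\Big| .$$ Then $$e_{\rm mass}=\Big|\int_0^{\delta_n}\!\!\int_\Omega\big[(1-\alpha)\Pi c^{(n)}\big](F_{-t}(x))\operatorname{div}u^{(n+1)}(x)\,dx\,dt-\delta_n\int_\Omega(1-\alpha)\operatorname{div}u^{(n+1)}\big(w\Pi c^{(n)}+(1-w)\Pi c^{(n+1)}\big)\,dx\Big| ,$$ and $$\begin{aligned}e_{\rm mass}\le{}&w\,\Big|\int_0^{\delta_n}\!\!\int_\Omega\Big(\big[(1-\alpha)\Pi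 c^{(n)}\big](F_{-t}(x))-\big[(1-\alpha)\Pi c^{(n)}\big](x)\Big)\operatorname{div}u^{(n+1)}(x)\,dx\,dt\Big|\\ &+(1-w)\,\Big|\int_0^{\delta_n}\!\!\int_\Omega\Big(\big[(1-\alpha)\Pi c^{(n)}\big](F_{-t}(x))-\big[(1-\alpha)\Pi c^{(n+1)}\big](x)\Big)\operatorname{div}u^{(n+1)}(x)\,dx\,dt\Big| .\end{aligned}$$ Consequently, with $U=\{x\in\Omega:\operatorname{div}u^{(n+1)}(x)\ne0\}$ and $B=\bigcup_{t\in[-\delta_n,0]}F_t(U)$: if $(1-\alpha)\Pi c^{(n)}=(1-\alpha)\Pi c^{(n+1)}=\kappa$ a.e. on $B$ for some constant $\kappa$, then $e_{\rm mass}=0$; in particular $e_{\rm mass}=0$ if $\alpha=1$ a.e. on $B$. -/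

import Mathlib

open MeasureTheory Set
open scoped ENNReal

namespace EllamMmoc

/-- The ambient space `ℝ^d` with its Euclidean norm. -/
abbrev Space (d : ℕ) := EuclideanSpace ℝ (Fin d)

/-- `L^∞(Ω)`. -/
noncomputable abbrev LInf {d : ℕ} (Ω : Set (Space d)) := Lp ℝ ∞ (volume.restrict Ω)

/-- A space-time gradient discretisation `(X, Π, ∇, I, (t^(n))_{n = 0, …, N})` of `Ω × (0, T)`;
the finite dimension of `X` is an instance argument wherever it is used. The values of `time`
beyond index `N` are irrelevant. -/
structure GradientDiscretisation {d : ℕ} (Ω : Set (Space d)) (T : ℝ)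
    (X : Type*) [AddCommGroup X] [Module ℝ X] where
  /-- function reconstruction `Π : X → L^∞(Ω)` -/
  recon : X →ₗ[ℝ] LInf Ω
  /-- gradient reconstruction `∇ : X → L^∞(Ω)^d` -/
  grad : X →ₗ[ℝ] Lp (Space d) ∞ (volume.restrict Ω)
  /-- interpolation of initial data -/
  interp : LInf Ω → X
  /-- number of time steps -/
  N : ℕ
  /-- discrete times `0 = t^(0) < ⋯ < t^(N) = T` -/
  time : ℕ → ℝ
  time_zero : time 0 = 0
  time_last : time N = T
  time_lt : ∀ n < N, time n < time (n + 1)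

/-- The time step `δt^(n+1/2) = t^(n+1) - t^(n)`. -/
def GradientDiscretisation.dt {d : ℕ} {Ω : Set (Space d)} {T : ℝ} {X : Type*}
    [AddCommGroup X] [Module ℝ X] (C : GradientDiscretisation Ω T X) (n : ℕ) : ℝ :=
  C.time (n + 1) - C.time n

/-- `g = div u` in the sense of distributions on `Ω`. -/
def IsWeakDivergence {d : ℕ} (Ω : Set (Space d)) (u : Space d → Space d) (g : Space d → ℝ) :
    Prop :=
  ∀ ψ : Space d → ℝ, ContDiff ℝ ((⊤ : ℕ∞) : WithTop ℕ∞) ψ → HasCompactSupport ψ →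
    tsupport ψ ⊆ Ω →
    ∫ x in Ω, fderiv ℝ ψ x (u x) = - ∫ x in Ω, g x * ψ x

/-- `F` is the flow on `Ω`, for times in `[-T, T]`, of the (possibly discontinuous) vector
field `b`: almost every point moves along a Carathéodory solution of `dF_t(x)/dt = b(F_t(x))`,
`F_0(x) = x`; the `F_t` satisfy the group law; and almost every point has a neighbourhood on
which the `F_t` are bi-Lipschitz with inverse `F_{-t}`, uniformly in `t`, so that the Jacobian
`|JF_t|` exists almost everywhere. Nothing is said here on how `F_t` transports volumes. -/
structure IsFlow {d : ℕ} (Ω : Set (Space d)) (T : ℝ) (b : Space d → Space d)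
    (F : ℝ → Space d → Space d) : Prop where
  mapsTo : ∀ t ∈ Icc (-T) T, MapsTo (F t) Ω Ω
  ode : ∀ᵐ x ∂(volume.restrict Ω),
    IntegrableOn (fun s => b (F s x)) (Icc (-T) T) ∧
      ∀ t ∈ Icc (-T) T, F t x = x + ∫ s in (0 : ℝ)..t, b (F s x)
  group : ∀ s ∈ Icc (-T) T, ∀ t ∈ Icc (-T) T, s + t ∈ Icc (-T) T →
    ∀ᵐ x ∂(volume.restrict Ω), F (s + t) x = F s (F t x)
  regular : ∀ᵐ x ∂(volume.restrict Ω), ∃ V : Set (Space d), ∃ L : NNReal,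
    IsOpen V ∧ x ∈ V ∧ V ⊆ Ω ∧ ∀ t ∈ Icc (-T) T,
      IsOpen (F t '' V) ∧ LeftInvOn (F (-t)) (F t) V ∧
      LipschitzOnWith L (F t) V ∧ LipschitzOnWith L (F (-t)) (F t '' V)

/-- How the source `f(s, x, t)` is sampled in time: at `t^(k)`, or by averaging. -/
inductive TimeRule
  | pointwise
  | average

/-- The source at index `k`: either `f(s, x, t^(k))`, or the average of `f(s, x, ·)` over
`(t^(k), t^(k+1))`, the last interval being reused for `k = N`. -/
noncomputable def sampledSource {d : ℕ} {Ω : Set (Space d)} {T : ℝ} {X : Type*}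
    [AddCommGroup X] [Module ℝ X] (C : GradientDiscretisation Ω T X)
    (f : ℝ → Space d → ℝ → ℝ) : TimeRule → ℕ → ℝ → Space d → ℝ
  | TimeRule.pointwise, k, s, x => f s x (C.time k)
  | TimeRule.average, k, s, x =>
      ⨍ τ in Ioo (C.time (min k (C.N - 1))) (C.time (min k (C.N - 1) + 1)), f s x τ

/-- `f_k = f(Π c^(k), ·, t^(k))` (or its time-averaged variant). -/
noncomputable def stepSource {d : ℕ} {Ω : Set (Space d)} {T : ℝ} {X : Type*}
    [AddCommGroup X] [Module ℝ X] (C : GradientDiscretisation Ω T X)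
    (f : ℝ → Space d → ℝ → ℝ) (rule : TimeRule) (c : ℕ → X) (k : ℕ) (x : Space d) : ℝ :=
  sampledSource C f rule k (C.recon (c k) x) x

/-- `c^(0), …, c^(N)` solves the combined ELLAM–MMOC scheme with splitting function `α` and
quadrature weight `w`. The functions `divu (n+1)` and `F (n+1)` are the divergence and the flow
of the velocity used on `(t^(n), t^(n+1))`. -/
structure IsEllamMmocSolution {d : ℕ} {Ω : Set (Space d)} {T : ℝ} {X : Type*}
    [AddCommGroup X] [Module ℝ X] (C : GradientDiscretisation Ω T X)
    (φ : Space d → ℝ) (f : ℝ → Space d → ℝ → ℝ) (rule : TimeRule) (cini : LInf Ω)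
    (divu : ℕ → Space d → ℝ) (F : ℕ → ℝ → Space d → Space d)
    (α : Space d → ℝ) (w : ℝ) (c : ℕ → X) : Prop where
  init : c 0 = C.interp cini
  step : ∀ n < C.N, ∀ z : X,
    (∫ x in Ω, φ x * C.recon (c (n + 1)) x * C.recon z x)
      - (∫ x in Ω, φ x * α x * C.recon (c n) x * C.recon z (F (n + 1) (C.dt n) x))
      - (∫ x in Ω, φ x *
          ((1 - α (F (n + 1) (-C.dt n) x)) * C.recon (c n) (F (n + 1) (-C.dt n) x)) *
          C.recon z x)
    = C.dt n * (∫ x in Ω, α x *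
          (w * stepSource C f rule c n x * C.recon z (F (n + 1) (C.dt n) x)
            + (1 - w) * stepSource C f rule c (n + 1) x * C.recon z x))
      + C.dt n * (∫ x in Ω, (1 - α x) *
          (w * stepSource C f rule c n x + (1 - w) * stepSource C f rule c (n + 1) x) *
          C.recon z x)
      - C.dt n * (∫ x in Ω, (1 - α x) * divu (n + 1) x *
          (w * C.recon (c n) x + (1 - w) * C.recon (c (n + 1)) x) * C.recon z x)

/-- The mass balance error `e_mass` over the step from `t^(n)` to `t^(n+1)`. -/
noncomputable def massBalanceError {d : ℕ} {Ω : Set (Space d)} {T : ℝ} {X : Type*}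
    [AddCommGroup X] [Module ℝ X] (C : GradientDiscretisation Ω T X)
    (φ : Space d → ℝ) (f : ℝ → Space d → ℝ → ℝ) (rule : TimeRule) (w : ℝ) (c : ℕ → X)
    (n : ℕ) : ℝ :=
  |(∫ x in Ω, φ x * C.recon (c (n + 1)) x) - (∫ x in Ω, φ x * C.recon (c n) x)
    - C.dt n * ∫ x in Ω,
        (w * stepSource C f rule c n x + (1 - w) * stepSource C f rule c (n + 1) x)|

/-- `[(1 - α) Π c^(k)](x)`, the part of the concentration treated by the MMOC. -/
noncomputable def mmocPart {d : ℕ} {Ω : Set (Space d)} {T : ℝ} {X : Type*}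
    [AddCommGroup X] [Module ℝ X] (C : GradientDiscretisation Ω T X)
    (α : Space d → ℝ) (c : ℕ → X) (k : ℕ) (x : Space d) : ℝ :=
  (1 - α x) * C.recon (c k) x

/-- The trace-back `F_{[-δ, 0]}(U) = ⋃_{t ∈ [-δ, 0]} F_t(U)` of `U = {x ∈ Ω | g(x) ≠ 0}`. -/
def traceBack {d : ℕ} (Ω : Set (Space d)) (g : Space d → ℝ) (F : ℝ → Space d → Space d)
    (δ : ℝ) : Set (Space d) :=
  ⋃ t ∈ Icc (-δ) 0, F t '' {x ∈ Ω | g x ≠ 0}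

end EllamMmoc

/-! ### Lipschitz functions, mollification, and calculus along Carathéodory curves. -/

section Analysis

open Filter Topology Function
open scoped NNReal Convolution ContDiff

/-! Write `m = (1 - α) Π c^(n)` and test the scheme with the element reconstructing 1. Since `F_δ`
pulls null sets back to null sets, `(Π z) ∘ F_δ = 1` a.e. as well; the source terms add up to the
one in the mass error, and everything reduces to the transport identity `∫ φ m∘F_{-δ} - ∫ φ m =
∫_0^δ ∫ (m∘F_{-t}) div u` (`IsFlow.transport`).

No equation for the Jacobian of the flow is available, so the identity is obtained by duality. Let
`h` be smooth with compact support in an open set where the flow is uniformly bi-Lipschitz. Along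
trajectories, `d/dt h(F_{-t} x) = -∇h(F_{-t} x) · b(F_{-t} x)`. Because `F_s` and `F_{-t}` commute,
this is also `-∇(h∘F_{-t})(x) · b(x)` (`IsFlow.ae_fderiv_transported`). Multiplication by `φ(x)`
turns `b(x)` into `u(x)`, and `h∘F_{-t}` is Lipschitz with compact support in `Ω`, hence admissible
in the weak divergence (`IsWeakDivergence.integral_fderiv_lipschitz`). Integration over `x` and `t`
gives `IsFlow.transport_smooth`.

For bounded `m`, each term of the identity is integration of `m` against some `L¹` density, by
Radon–Nikodym (`exists_density_comp`). The identity for smooth `h` makes the defect of the densities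
vanish on every regular open set, hence a.e. in `Ω`.

The upper bound is the splitting `1 = w + (1 - w)`. If `m` and its counterpart at step `n + 1` are a
common constant on the trace-back of `{div u ≠ 0}`, both integrands vanish a.e. -/

theorem LipschitzOnWith.volume_image_eq_zero {d : ℕ} {g : EllamMmoc.Space d → EllamMmoc.Space d}
    {L : ℝ≥0} {s : Set (EllamMmoc.Space d)} (hg : LipschitzOnWith L g s) (hs : volume s = 0) :
    volume (g '' s) = 0 := by
  have hH : (volume : Measure (EllamMmoc.Space d)) ≪ μH[d] :=
    Measure.absolutelyContinuous_isAddHaarMeasure _ _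
  have hH' : (μH[d] : Measure (EllamMmoc.Space d)) ≪ volume :=
    Measure.absolutelyContinuous_isAddHaarMeasure _ _
  -- Lebesgue measure and `μH[d]` have the same null sets, and Lipschitz maps control the latter.
  refine hH (le_antisymm ?_ zero_le)
  refine (hg.hausdorffMeasure_image_le (Nat.cast_nonneg d)).trans ?_
  rw [hH' hs, mul_zero]

/-- A function that is Lipschitz relative to an open set, with compact support in that set, is
Lipschitz when extended by zero. -/
theorem LipschitzOnWith.lipschitzWith_of_eq_zero_off_compact {E : Type*} [NormedAddCommGroup E]
    [NormedSpace ℝ E] {g : E → ℝ} {C : ℝ≥0} {O K : Set E} (hO : IsOpen O) (hK : IsCompact K)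
    (hKO : K ⊆ O) (hg : LipschitzOnWith C g O) (h0 : ∀ x ∉ K, g x = 0) : LipschitzWith C g := by
  have key : ∀ x ∈ O, ∀ y ∉ O, |g x - g y| ≤ C * ‖x - y‖ := by
    intro x hx y hy
    rw [h0 y fun h => hy (hKO h), sub_zero]
    by_cases hxK : x ∈ K
    · -- the segment from `x` to `y` meets `O \ K`
      obtain ⟨z, hz, hzO, hzK⟩ : ∃ z ∈ segment ℝ x y, z ∈ O ∧ z ∉ K := by
        by_contra! hcon
        have hconn : IsPreconnected (segment ℝ x y) := (convex_segment x y).isPreconnected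
        have := hconn O Kᶜ hO hK.isClosed.isOpen_compl
          (fun z _ => by by_cases h : z ∈ K; exacts [Or.inl (hKO h), Or.inr h])
          ⟨x, left_mem_segment ℝ x y, hx⟩ ⟨y, right_mem_segment ℝ x y, fun h => hy (hKO h)⟩
        obtain ⟨z, hz, hzO, hzK⟩ := this
        exact hzK (hcon z hz hzO)
      have h1 := hg.dist_le_mul x hx z hzO
      rw [h0 z hzK, Real.dist_eq, sub_zero, dist_eq_norm] at h1
      refine h1.trans (mul_le_mul_of_nonneg_left ?_ C.2)
      rw [segment_eq_image'] at hz
      obtain ⟨θ, hθ, rfl⟩ := hz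
      rw [sub_add_cancel_left, norm_neg, norm_smul, Real.norm_eq_abs, abs_of_nonneg hθ.1,
        norm_sub_rev x y]
      exact mul_le_of_le_one_left (norm_nonneg _) hθ.2
    · rw [h0 x hxK, abs_zero]; positivity
  refine LipschitzWith.of_dist_le_mul fun x y => ?_
  rw [Real.dist_eq, dist_eq_norm]
  by_cases hx : x ∈ O <;> by_cases hy : y ∈ O
  · simpa [Real.dist_eq, dist_eq_norm] using hg.dist_le_mul x hx y hy
  · exact key x hx y hy
  · rw [abs_sub_comm, norm_sub_rev]; exact key y hy x hx
  · rw [h0 x fun h => hx (hKO h), h0 y fun h => hy (hKO h), sub_zero, abs_zero]; positivity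

/-- Differentiation of the mollification of a Lipschitz function. -/
theorem LipschitzWith.hasFDerivAt_normed_convolution {E : Type*} [NormedAddCommGroup E]
    [InnerProductSpace ℝ E] [FiniteDimensional ℝ E] [MeasurableSpace E] [BorelSpace E]
    {ψ : E → ℝ} {C : ℝ≥0} (hψ : LipschitzWith C ψ) (ρ : ContDiffBump (0 : E)) (x : E) :
    HasFDerivAt (ρ.normed volume ⋆[ContinuousLinearMap.lsmul ℝ ℝ, volume] ψ)
      ((ρ.normed volume ⋆[ContinuousLinearMap.lsmul ℝ ℝ, volume] (fderiv ℝ ψ)) x) x := by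
  have hsub : MeasurePreserving (fun t : E => x - t) volume volume :=
    Measure.measurePreserving_sub_left volume x
  have hd : ∀ᵐ t : E, DifferentiableAt ℝ ψ (x - t) :=
    hsub.quasiMeasurePreserving.ae hψ.ae_differentiableAt
  refine (hasFDerivAt_integral_of_dominated_loc_of_lip (F := fun y t => ρ.normed volume t • ψ (y - t))
    (F' := fun t => ρ.normed volume t • fderiv ℝ ψ (x - t))
    (bound := fun t => ρ.normed volume t * C) (s := univ) univ_mem ?_ ?_ ?_ ?_ ?_ ?_).2
  · refine Eventually.of_forall fun y => Continuous.aestronglyMeasurable ?_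
    exact ρ.continuous_normed.smul (hψ.continuous.comp (continuous_const.sub continuous_id))
  · refine Continuous.integrable_of_hasCompactSupport ?_ ?_
    · exact ρ.continuous_normed.smul (hψ.continuous.comp (continuous_const.sub continuous_id))
    · exact ρ.hasCompactSupport_normed.smul_right
  · refine ρ.continuous_normed.aestronglyMeasurable.smul ?_
    exact ((measurable_fderiv ℝ ψ).comp hsub.measurable).aestronglyMeasurable
  · refine Eventually.of_forall fun t => LipschitzWith.lipschitzOnWith ?_
    refine LipschitzWith.of_dist_le_mul fun y z => ?_
    have h := hψ.dist_le_mul (y - t) (z - t)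
    rw [dist_sub_right] at h
    rw [dist_smul₀, Real.norm_eq_abs, Real.coe_nnabs, abs_mul, NNReal.abs_eq, mul_assoc]
    exact mul_le_mul_of_nonneg_left h (abs_nonneg _)
  · exact ρ.integrable_normed.mul_const _
  · filter_upwards [hd] with t ht
    have h1 : HasFDerivAt (fun y => ψ (y - t)) (fderiv ℝ ψ (x - t)) x :=
      ht.hasFDerivAt.comp x ((hasFDerivAt_id x).sub_const t)
    exact h1.const_smul (ρ.normed volume t)

/-- Averaging against a probability density preserves a uniform bound. It dominates the mollified
functions and the mollified gradients alike. -/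
theorem ContDiffBump.norm_normed_convolution_le {E F : Type*} [NormedAddCommGroup E]
    [InnerProductSpace ℝ E] [FiniteDimensional ℝ E] [MeasurableSpace E] [BorelSpace E]
    [NormedAddCommGroup F] [NormedSpace ℝ F] (ρ : ContDiffBump (0 : E)) {g : E → F} {M : ℝ}
    (hg : ∀ x, ‖g x‖ ≤ M) (x : E) :
    ‖(ρ.normed volume ⋆[ContinuousLinearMap.lsmul ℝ ℝ, volume] g) x‖ ≤ M := by
  refine (norm_integral_le_of_norm_le (ρ.integrable_normed.mul_const M)
    (Eventually.of_forall fun t => ?_)).trans ?_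
  · simp only [ContinuousLinearMap.lsmul_apply, norm_smul, Real.norm_eq_abs,
      abs_of_nonneg (ρ.nonneg_normed t)]
    exact mul_le_mul_of_nonneg_left (hg _) (ρ.nonneg_normed t)
  · rw [integral_mul_const, ρ.integral_normed, one_mul]

/-- Mollifications of `ψ` at radii below the distance from its support to the complement of `Ω` are
smooth test functions. Their gradients are mollified gradients, bounded by `C` and convergent a.e.,
so dominated convergence applies on both sides. -/
theorem EllamMmoc.IsWeakDivergence.integral_fderiv_lipschitz {d : ℕ} {Ω : Set (EllamMmoc.Space d)}
    (hΩ : IsOpen Ω) {u : EllamMmoc.Space d → EllamMmoc.Space d} {g : EllamMmoc.Space d → ℝ}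
    (h : EllamMmoc.IsWeakDivergence Ω u g) (hu : IntegrableOn u Ω) (hg : IntegrableOn g Ω)
    {ψ : EllamMmoc.Space d → ℝ} {C : ℝ≥0} (hψ : LipschitzWith C ψ) (hc : HasCompactSupport ψ)
    (hs : tsupport ψ ⊆ Ω) :
    ∫ x in Ω, fderiv ℝ ψ x (u x) = - ∫ x in Ω, g x * ψ x := by
  obtain ⟨r, hr, hrΩ⟩ := hc.isCompact.exists_cthickening_subset_open hΩ hs
  -- The fixed ratio 2 of the radii is what a.e. convergence at Lebesgue points asks for (`K := 2`
  -- below).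
  let ρ : ℕ → ContDiffBump (0 : EllamMmoc.Space d) := fun n =>
    { rIn := r / (n + 1) / 2
      rOut := r / (n + 1)
      rIn_pos := by positivity
      rIn_lt_rOut := half_lt_self (by positivity) }
  have hρ : Tendsto (fun n => (ρ n).rOut) atTop (𝓝 0) := by
    simpa [ρ, div_eq_mul_inv] using (tendsto_one_div_add_atTop_nhds_zero_nat (𝕜 := ℝ)).const_mul r
  have hρr : ∀ n, (ρ n).rOut ≤ r := fun n =>
    div_le_self hr.le (by linarith [(Nat.cast_nonneg n : (0 : ℝ) ≤ n)])
  let ψn : ℕ → EllamMmoc.Space d → ℝ := fun n =>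
    (ρ n).normed volume ⋆[ContinuousLinearMap.lsmul ℝ ℝ, volume] ψ
  have hfd : ∀ n x, fderiv ℝ (ψn n) x =
      ((ρ n).normed volume ⋆[ContinuousLinearMap.lsmul ℝ ℝ, volume] (fderiv ℝ ψ)) x :=
    fun n x => (hψ.hasFDerivAt_normed_convolution (ρ n) x).fderiv
  have hfC : ∀ x, ‖fderiv ℝ ψ x‖ ≤ C := fun x => norm_fderiv_le_of_lipschitz ℝ hψ
  obtain ⟨M, hM⟩ := hc.exists_bound_of_continuous hψ.continuous
  have hsm : ∀ n, ContDiff ℝ ((⊤ : ℕ∞) : WithTop ℕ∞) (ψn n) := fun n =>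
    (ρ n).hasCompactSupport_normed.contDiff_convolution_left _ (ρ n).contDiff_normed
      hψ.continuous.locallyIntegrable
  have hcn : ∀ n, HasCompactSupport (ψn n) := fun n =>
    (ρ n).hasCompactSupport_normed.convolution _ hc
  have hsn : ∀ n, tsupport (ψn n) ⊆ Ω := by
    intro n
    refine Subset.trans (closure_minimal ?_ Metric.isClosed_cthickening) hrΩ
    refine (support_convolution_subset _).trans ?_
    rintro _ ⟨a, ha, b, hb, rfl⟩
    rw [ContDiffBump.support_normed_eq, mem_ball_zero_iff] at ha
    refine Metric.mem_cthickening_of_dist_le _ b _ _ (subset_tsupport _ hb) ?_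
    rw [dist_eq_norm, add_sub_cancel_right]
    exact ha.le.trans (hρr n)
  have hlim1 : Tendsto (fun n => ∫ x in Ω, fderiv ℝ (ψn n) x (u x)) atTop
      (𝓝 (∫ x in Ω, fderiv ℝ ψ x (u x))) := by
    refine tendsto_integral_of_dominated_convergence (fun x => C * ‖u x‖) ?_ ?_ ?_ ?_
    · intro n
      have hm : AEStronglyMeasurable (fderiv ℝ (ψn n)) (volume.restrict Ω) :=
        (measurable_fderiv ℝ (ψn n)).aestronglyMeasurable
      exact (ContinuousLinearMap.apply ℝ ℝ).aestronglyMeasurable_comp₂ hu.aestronglyMeasurable hm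
    · exact hu.norm.const_mul _
    · intro n
      refine Eventually.of_forall fun x => ?_
      rw [hfd]
      refine (ContinuousLinearMap.le_opNorm _ _).trans ?_
      exact mul_le_mul_of_nonneg_right ((ρ n).norm_normed_convolution_le hfC x) (norm_nonneg _)
    · have hloc : LocallyIntegrable (fderiv ℝ ψ) (volume : Measure (EllamMmoc.Space d)) := by
        refine MemLp.locallyIntegrable (p := ∞) ?_ le_top
        exact memLp_top_of_bound (measurable_fderiv ℝ ψ).aestronglyMeasurable C
          (Eventually.of_forall hfC)
      refine ae_restrict_of_ae ?_
      filter_upwards [ContDiffBump.ae_convolution_tendsto_right_of_locallyIntegrable (K := 2) hρ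
        (Eventually.of_forall fun n => (by simp only [ρ]; linarith)) hloc] with x hx
      simp only [hfd]
      exact ((ContinuousLinearMap.apply ℝ ℝ (u x)).continuous.tendsto _).comp hx
  have hlim2 : Tendsto (fun n => - ∫ x in Ω, g x * ψn n x) atTop
      (𝓝 (- ∫ x in Ω, g x * ψ x)) := by
    refine (tendsto_integral_of_dominated_convergence (fun x => ‖g x‖ * M) ?_ ?_ ?_ ?_).neg
    · exact fun n => hg.aestronglyMeasurable.mul (hsm n).continuous.aestronglyMeasurable
    · exact hg.norm.mul_const _
    · intro n
      refine Eventually.of_forall fun x => ?_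
      rw [norm_mul]
      exact mul_le_mul_of_nonneg_left ((ρ n).norm_normed_convolution_le hM x) (norm_nonneg _)
    · refine Eventually.of_forall fun x => Tendsto.const_mul _ ?_
      exact ContDiffBump.convolution_tendsto_right_of_continuous hρ hψ.continuous x
  refine tendsto_nhds_unique hlim1 (hlim2.congr fun n => ?_)
  exact (h _ (hsm n) (hcn n) (hsn n)).symm

/-- Fundamental theorem of calculus along a Carathéodory curve. -/
theorem integral_fderiv_comp_primitive {E : Type*} [NormedAddCommGroup E] [NormedSpace ℝ E]
    [CompleteSpace E] {h : E → ℝ} (hh : ContDiff ℝ 1 h) {K : ℝ≥0} (hK : LipschitzWith K h)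
    {v : ℝ → E} {a b : ℝ} {γ : ℝ → E} {x : E} (hv : IntervalIntegrable v volume a b) {c : ℝ}
    (hc : c ∈ uIcc a b) (hγ : ∀ t ∈ uIcc a b, γ t = x + ∫ s in c..t, v s) :
    ∫ s in a..b, fderiv ℝ h (γ s) (v s) = h (γ b) - h (γ a) := by
  let Γ : ℝ → E := fun t => x + ∫ s in c..t, v s
  have hint : ∀ s ∈ uIcc a b, ∀ t ∈ uIcc a b, IntervalIntegrable v volume s t := fun s hs t ht =>
    hv.mono_set (uIcc_subset_uIcc hs ht)
  -- Increments of `h ∘ Γ` are at most `K` times those of the primitive of `‖v‖`, which is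
  -- absolutely continuous.
  have hac : AbsolutelyContinuousOnInterval (fun t => h (Γ t)) a b := by
    have h1 := (hv.norm.absolutelyContinuousOnInterval_intervalIntegral hc).const_mul (K : ℝ)
    refine squeeze_zero' (Eventually.of_forall fun _ => Finset.sum_nonneg fun _ _ => dist_nonneg)
      ?_ h1
    filter_upwards [mem_inf_of_right (mem_principal_self _)] with E hE
    refine Finset.sum_le_sum fun i hi => ?_
    obtain ⟨hs, ht⟩ := hE.1 i hi
    generalize (E.2 i).1 = s at *
    generalize (E.2 i).2 = t at *
    refine (hK.dist_le_mul _ _).trans ?_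
    rw [Real.dist_eq, ← mul_sub, abs_mul, NNReal.abs_eq]
    refine mul_le_mul_of_nonneg_left ?_ K.2
    rw [intervalIntegral.integral_interval_sub_left (hint c hc s hs).norm (hint c hc t ht).norm,
      dist_eq_norm]
    simp only [Γ, add_sub_add_left_eq_sub]
    rw [intervalIntegral.integral_interval_sub_left (hint c hc s hs) (hint c hc t ht)]
    exact intervalIntegral.norm_integral_le_abs_integral_norm
  have hd := hv.ae_hasDerivAt_integral
  rw [hγ b right_mem_uIcc, hγ a left_mem_uIcc, ← hac.integral_deriv_eq_sub]
  refine intervalIntegral.integral_congr_ae ?_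
  filter_upwards [hd] with s hs hs'
  have hsu := uIoc_subset_uIcc hs'
  have hΓ : HasDerivAt Γ (v s) s := (hs hsu c hc).const_add x
  have hcomp : HasDerivAt (fun t => h (Γ t)) (fderiv ℝ h (Γ s) (v s)) s :=
    ((hh.differentiable one_ne_zero).differentiableAt (x := Γ s)).hasFDerivAt.comp_hasDerivAt s hΓ
  rw [hcomp.deriv, hγ s hsu]

end Analysis

/-! ### Exchanging almost-everywhere quantifiers. -/

section NullMeasurable

variable {α β : Type*} [MeasurableSpace α] [MeasurableSpace β] {μ : Measure α} {ν : Measure β}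
  [SFinite ν]

/-- Fubini for null sets, applied to a measurable subset that differs from the given set by a null
set. -/
theorem MeasureTheory.NullMeasurableSet.ae_prod_of_ae_ae {p : α → β → Prop}
    (hp : NullMeasurableSet {q : α × β | p q.1 q.2} (μ.prod ν))
    (h : ∀ᵐ x ∂μ, ∀ᵐ y ∂ν, p x y) : ∀ᵐ q ∂(μ.prod ν), p q.1 q.2 := by
  obtain ⟨t, hts, htm, hte⟩ := hp.exists_measurable_subset_ae_eq
  have h1 : ∀ᵐ q ∂(μ.prod ν), q ∈ t := by
    rw [ae_iff]
    have hm : MeasurableSet {q | q ∉ t} := htm.compl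
    rw [Measure.measure_prod_null hm]
    filter_upwards [h, Measure.ae_ae_of_ae_prod hte.mem_iff] with x hx hx'
    change ν {y | ¬ (x, y) ∈ t} = 0
    rw [← ae_iff]
    filter_upwards [hx, hx'] with y hy hy'
    exact hy'.2 hy
  filter_upwards [h1] with q hq using hts hq

/-- The flow equation gives properties for a.e. `x` at a.e. time; this permits fixing one time that
is good for a.e. `x`. -/
theorem MeasureTheory.NullMeasurableSet.ae_ae_swap [SFinite μ] {p : α → β → Prop}
    (hp : NullMeasurableSet {q : α × β | p q.1 q.2} (μ.prod ν))
    (h : ∀ᵐ y ∂ν, ∀ᵐ x ∂μ, p x y) : ∀ᵐ x ∂μ, ∀ᵐ y ∂ν, p x y := by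
  have hswap : NullMeasurableSet {q : β × α | p q.2 q.1} (ν.prod μ) :=
    hp.preimage Measure.measurePreserving_swap.quasiMeasurePreserving
  have h1 := NullMeasurableSet.ae_prod_of_ae_ae (p := fun y x => p x y) hswap h
  exact Measure.ae_ae_of_ae_prod
    ((Measure.measurePreserving_swap (μ := μ) (ν := ν)).quasiMeasurePreserving.ae h1)

end NullMeasurable

/-! ### Regular points, nonsingularity, measurability and initial velocity of the flow. -/

namespace EllamMmoc

open Filter Topology Function
open scoped NNReal

/-- `V` is an open subset of `Ω` on which the maps `F_t` are bi-Lipschitz with inverse `F_{-t}`,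
uniformly in `t`. -/
structure IsRegularOn {d : ℕ} (Ω : Set (Space d)) (T : ℝ) (F : ℝ → Space d → Space d)
    (V : Set (Space d)) (L : ℝ≥0) : Prop where
  isOpen : IsOpen V
  subset : V ⊆ Ω
  isOpen_image : ∀ t ∈ Icc (-T) T, IsOpen (F t '' V)
  leftInvOn : ∀ t ∈ Icc (-T) T, LeftInvOn (F (-t)) (F t) V
  lipschitz : ∀ t ∈ Icc (-T) T, LipschitzOnWith L (F t) V
  lipschitz_inv : ∀ t ∈ Icc (-T) T, LipschitzOnWith L (F (-t)) (F t '' V)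

/-- The union of all sets on which the flow is regular. -/
def regularSet {d : ℕ} (Ω : Set (Space d)) (T : ℝ) (F : ℝ → Space d → Space d) :
    Set (Space d) :=
  ⋃₀ {V | ∃ L, IsRegularOn Ω T F V L}

namespace IsFlow

variable {d : ℕ} {Ω : Set (Space d)} {T : ℝ} {b : Space d → Space d}
  {F : ℝ → Space d → Space d}

theorem isOpen_regularSet : IsOpen (regularSet Ω T F) :=
  isOpen_sUnion fun _ ⟨_, hV⟩ => hV.isOpen

theorem regularSet_subset : regularSet Ω T F ⊆ Ω :=
  sUnion_subset fun _ ⟨_, hV⟩ => hV.subset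

theorem ae_mem_regularSet (hF : IsFlow Ω T b F) :
    ∀ᵐ x ∂(volume.restrict Ω), x ∈ regularSet Ω T F := by
  filter_upwards [hF.regular] with x ⟨V, L, hV, hx, hVΩ, h⟩
  exact ⟨V, ⟨L, hV, hVΩ, fun t ht => (h t ht).1, fun t ht => (h t ht).2.1,
    fun t ht => (h t ht).2.2.1, fun t ht => (h t ht).2.2.2⟩, hx⟩

theorem neg_mem_Icc {t : ℝ} (ht : t ∈ Icc (-T) T) : -t ∈ Icc (-T) T :=
  ⟨neg_le_neg ht.2, neg_le.1 ht.1⟩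

theorem restrict_regularSet (hF : IsFlow Ω T b F) (hΩ : IsOpen Ω) :
    volume.restrict (regularSet Ω T F) = volume.restrict Ω := by
  refine Measure.restrict_congr_set ?_
  have h := (ae_restrict_iff' hΩ.measurableSet).1 hF.ae_mem_regularSet
  filter_upwards [h] with x hx
  exact propext ⟨fun h => regularSet_subset h, hx⟩

/-- Inside a regular `V`, the preimage of a null set under `F_t` lies in the image under the
Lipschitz map `F_{-t}` of a null set. Locally null sets are null. -/
theorem ae_comp (hF : IsFlow Ω T b F) (hΩ : IsOpen Ω) {t : ℝ} (ht : t ∈ Icc (-T) T)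
    {p : Space d → Prop} (hp : ∀ᵐ x ∂(volume.restrict Ω), p x) :
    ∀ᵐ x ∂(volume.restrict Ω), p (F t x) := by
  have hN : volume {x | x ∈ Ω ∧ ¬ p x} = 0 := by
    have := (ae_restrict_iff' hΩ.measurableSet).1 hp
    simpa [ae_iff] using this
  have hnull : volume {x | x ∈ regularSet Ω T F ∧ ¬ p (F t x)} = 0 := by
    refine measure_null_of_locally_null _ fun x hx => ?_
    obtain ⟨V, ⟨L, hV⟩, hxV⟩ := hx.1
    refine ⟨V ∩ {x | x ∈ regularSet Ω T F ∧ ¬ p (F t x)},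
      inter_mem (mem_nhdsWithin_of_mem_nhds (hV.isOpen.mem_nhds hxV)) self_mem_nhdsWithin, ?_⟩
    have hlip : LipschitzOnWith L (F (-t)) ({x | x ∈ Ω ∧ ¬ p x} ∩ F t '' V) :=
      (hV.lipschitz_inv t ht).mono inter_subset_right
    refine measure_mono_null ?_ (hlip.volume_image_eq_zero
      (measure_mono_null inter_subset_left hN))
    rintro y ⟨hyV, -, hy⟩
    exact ⟨F t y, ⟨⟨hF.mapsTo t ht (hV.subset hyV), hy⟩, mem_image_of_mem _ hyV⟩,
      hV.leftInvOn t ht hyV⟩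
  rw [← hF.restrict_regularSet hΩ, ae_restrict_iff' isOpen_regularSet.measurableSet, ae_iff]
  simpa using hnull

theorem ae_zero (hF : IsFlow Ω T b F) (hT : 0 ≤ T) :
    ∀ᵐ x ∂(volume.restrict Ω), F 0 x = x := by
  filter_upwards [hF.ode] with x hx
  simpa using hx.2 0 ⟨by linarith, hT⟩

theorem ae_comp_neg (hF : IsFlow Ω T b F) (hT : 0 ≤ T) {t : ℝ} (ht : t ∈ Icc (-T) T) :
    ∀ᵐ x ∂(volume.restrict Ω), F t (F (-t) x) = x := by
  filter_upwards [hF.ae_zero hT, hF.group t ht (-t) (neg_mem_Icc ht)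
    (by rw [add_neg_cancel]; exact ⟨by linarith, hT⟩)] with x h0 h
  rw [← h, add_neg_cancel, h0]

theorem intervalIntegrable {x : Space d} (hT : 0 ≤ T)
    (hx : IntegrableOn (fun s => b (F s x)) (Icc (-T) T)) {s t : ℝ} (hs : s ∈ Icc (-T) T)
    (ht : t ∈ Icc (-T) T) : IntervalIntegrable (fun s => b (F s x)) volume s t := by
  have h : IntervalIntegrable (fun s => b (F s x)) volume (-T) T := by
    rw [intervalIntegrable_iff_integrableOn_Icc_of_le (by linarith)]
    exact hx
  refine h.mono_set (uIcc_subset_uIcc ?_ ?_) <;> rwa [uIcc_of_le (by linarith)]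

theorem continuousOn_time (hT : 0 ≤ T) {x : Space d}
    (hx : IntegrableOn (fun s => b (F s x)) (Icc (-T) T))
    (h : ∀ t ∈ Icc (-T) T, F t x = x + ∫ s in (0 : ℝ)..t, b (F s x)) :
    ContinuousOn (fun t => F t x) (Icc (-T) T) := by
  have hu : uIcc (-T) T = Icc (-T) T := uIcc_of_le (by linarith)
  have hc : ContinuousOn (fun t => ∫ s in (0 : ℝ)..t, b (F s x)) (Icc (-T) T) := by
    rw [← hu] at hx ⊢
    exact intervalIntegral.continuousOn_primitive_interval' (by
      rw [intervalIntegrable_iff]; exact hx.mono_set uIoc_subset_uIcc) (by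
      rw [hu]; exact ⟨by linarith, hT⟩)
  exact (continuousOn_const.add hc).congr h

/-- Trajectories are continuous in time for a.e. `x`, hence for a dense set of `x` in `V`; the
Lipschitz bound in `x`, uniform in `t`, extends this to joint continuity on all of `V`. -/
theorem continuousOn_of_isRegularOn (hF : IsFlow Ω T b F) (hΩ : IsOpen Ω) (hT : 0 ≤ T)
    {V : Set (Space d)} {L : ℝ≥0} (hV : IsRegularOn Ω T F V L) :
    ContinuousOn (fun q : ℝ × Space d => F q.1 q.2) (Icc (-T) T ×ˢ V) := by
  have hae : ∀ᵐ x : Space d, x ∈ Ω → ContinuousOn (fun t => F t x) (Icc (-T) T) := by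
    refine (ae_restrict_iff' hΩ.measurableSet).1 ?_
    filter_upwards [hF.ode] with x hx
    exact continuousOn_time hT hx.1 hx.2
  have hd := Measure.dense_of_ae hae
  exact continuousOn_prod_of_subset_closure_continuousOn_lipschitzOnWith'
    (fun q : ℝ × Space d => F q.1 q.2) inter_subset_left (hd.open_subset_closure_inter hV.isOpen)
    L (fun t ht => hV.lipschitz t ht) (fun x hx => hx.2 (hV.subset hx.1))

theorem continuousOn_regularSet (hF : IsFlow Ω T b F) (hΩ : IsOpen Ω) (hT : 0 ≤ T) :
    ContinuousOn (fun q : ℝ × Space d => F q.1 q.2) (Icc (-T) T ×ˢ regularSet Ω T F) := by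
  rintro ⟨t, x⟩ ⟨ht, V, ⟨L, hV⟩, hxV⟩
  refine (hF.continuousOn_of_isRegularOn hΩ hT hV (t, x) ⟨ht, hxV⟩).mono_of_mem_nhdsWithin ?_
  rw [nhdsWithin_prod_eq]
  exact prod_mem_prod self_mem_nhdsWithin (mem_nhdsWithin_of_mem_nhds (hV.isOpen.mem_nhds hxV))

section Joint

variable {S : Set ℝ} {σ : ℝ → ℝ}

theorem aemeasurable_prod (hF : IsFlow Ω T b F) (hΩ : IsOpen Ω) (hT : 0 ≤ T)
    (hS : MeasurableSet S) (hσ : Continuous σ) (hσS : MapsTo σ S (Icc (-T) T)) :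
    AEMeasurable (fun q : ℝ × Space d => F (σ q.1) q.2)
      ((volume.restrict S).prod (volume.restrict Ω)) := by
  rw [← hF.restrict_regularSet hΩ, Measure.prod_restrict]
  refine ContinuousOn.aemeasurable ?_ (hS.prod isOpen_regularSet.measurableSet)
  refine (hF.continuousOn_regularSet hΩ hT).comp
    (f := fun q : ℝ × Space d => (σ q.1, q.2)) (by fun_prop) ?_
  exact fun q hq => ⟨hσS hq.1, hq.2⟩

/-- Each time slice is nonsingular by `ae_comp`. This gives meaning to the composition of the
space-time flow with functions known only up to null sets. -/
theorem map_prod_absolutelyContinuous (hF : IsFlow Ω T b F) (hΩ : IsOpen Ω) (hT : 0 ≤ T)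
    (hS : MeasurableSet S) (hσ : Continuous σ) (hσS : MapsTo σ S (Icc (-T) T)) :
    Measure.map (fun q : ℝ × Space d => F (σ q.1) q.2)
      ((volume.restrict S).prod (volume.restrict Ω)) ≪ volume.restrict Ω := by
  have hm := hF.aemeasurable_prod hΩ hT hS hσ hσS
  refine Measure.AbsolutelyContinuous.mk fun s hs hs0 => ?_
  rw [Measure.map_apply_of_aemeasurable hm hs]
  have hnm := hm.nullMeasurableSet_preimage hs.compl
  have hs' : ∀ᵐ x ∂(volume.restrict Ω), x ∈ sᶜ := by simpa [ae_iff] using hs0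
  have := NullMeasurableSet.ae_prod_of_ae_ae (p := fun t x => F (σ t) x ∈ sᶜ) hnm (by
    filter_upwards [ae_restrict_mem hS] with t ht
    exact hF.ae_comp hΩ (hσS ht) hs')
  rw [ae_iff] at this
  simpa [preimage] using this

theorem ae_comp_prod (hF : IsFlow Ω T b F) (hΩ : IsOpen Ω) (hT : 0 ≤ T)
    (hS : MeasurableSet S) (hσ : Continuous σ) (hσS : MapsTo σ S (Icc (-T) T))
    {p : Space d → Prop} (hp : ∀ᵐ x ∂(volume.restrict Ω), p x) :
    ∀ᵐ q ∂((volume.restrict S).prod (volume.restrict Ω)), p (F (σ q.1) q.2) :=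
  ae_of_ae_map (hF.aemeasurable_prod hΩ hT hS hσ hσS)
    ((hF.map_prod_absolutelyContinuous hΩ hT hS hσ hσS).ae_le hp)

theorem aestronglyMeasurable_comp_prod (hF : IsFlow Ω T b F) (hΩ : IsOpen Ω) (hT : 0 ≤ T)
    (hS : MeasurableSet S) (hσ : Continuous σ) (hσS : MapsTo σ S (Icc (-T) T))
    {E : Type*} [TopologicalSpace E] {g : Space d → E}
    (hg : AEStronglyMeasurable g (volume.restrict Ω)) :
    AEStronglyMeasurable (fun q : ℝ × Space d => g (F (σ q.1) q.2))
      ((volume.restrict S).prod (volume.restrict Ω)) :=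
  (hg.mono_ac (hF.map_prod_absolutelyContinuous hΩ hT hS hσ hσS)).comp_aemeasurable
    (hF.aemeasurable_prod hΩ hT hS hσ hσS)

end Joint

theorem aemeasurable (hF : IsFlow Ω T b F) (hΩ : IsOpen Ω) {t : ℝ}
    (ht : t ∈ Icc (-T) T) : AEMeasurable (F t) (volume.restrict Ω) := by
  rw [← hF.restrict_regularSet hΩ]
  refine ContinuousOn.aemeasurable ?_ isOpen_regularSet.measurableSet
  rintro x ⟨V, ⟨L, hV⟩, hxV⟩
  exact ((hV.lipschitz t ht).continuousOn.continuousAt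
    (hV.isOpen.mem_nhds hxV)).continuousWithinAt

theorem map_absolutelyContinuous (hF : IsFlow Ω T b F) (hΩ : IsOpen Ω) {t : ℝ}
    (ht : t ∈ Icc (-T) T) :
    Measure.map (F t) (volume.restrict Ω) ≪ volume.restrict Ω := by
  refine Measure.AbsolutelyContinuous.mk fun s hs hs0 => ?_
  rw [Measure.map_apply_of_aemeasurable (hF.aemeasurable hΩ ht) hs]
  have hs' : ∀ᵐ x ∂(volume.restrict Ω), x ∉ s := by simpa [ae_iff] using hs0
  simpa [ae_iff, preimage] using hF.ae_comp hΩ ht hs'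

theorem aestronglyMeasurable_comp (hF : IsFlow Ω T b F) (hΩ : IsOpen Ω) {t : ℝ}
    (ht : t ∈ Icc (-T) T) {E : Type*} [TopologicalSpace E] {g : Space d → E}
    (hg : AEStronglyMeasurable g (volume.restrict Ω)) :
    AEStronglyMeasurable (fun x => g (F t x)) (volume.restrict Ω) :=
  (hg.mono_ac (hF.map_absolutelyContinuous hΩ ht)).comp_aemeasurable (hF.aemeasurable hΩ ht)

/-- A sequence of positive times tending to `0`. -/
noncomputable def smallTime (T : ℝ) (n : ℕ) : ℝ := T / 2 / (n + 1)

theorem smallTime_pos (hT : 0 < T) (n : ℕ) : 0 < smallTime T n := by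
  unfold smallTime; positivity

theorem smallTime_le (hT : 0 < T) (n : ℕ) : smallTime T n ≤ T / 2 :=
  div_le_self (by positivity) (by linarith [(Nat.cast_nonneg n : (0 : ℝ) ≤ n)])

theorem tendsto_smallTime (T : ℝ) : Tendsto (smallTime T) atTop (𝓝 0) := by
  have := (tendsto_one_div_add_atTop_nhds_zero_nat (𝕜 := ℝ)).const_mul (T / 2)
  exact (by simpa [div_eq_mul_inv] using this : Tendsto (fun n : ℕ => T / 2 / ((n : ℝ) + 1)) atTop (𝓝 0))

theorem tendsto_smallTime_nhdsGT (hT : 0 < T) : Tendsto (smallTime T) atTop (𝓝[>] 0) :=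
  tendsto_nhdsWithin_iff.2 ⟨tendsto_smallTime T, Eventually.of_forall (smallTime_pos hT)⟩

/-- The vector field is, almost everywhere, the velocity of the flow at time `0`. -/
theorem ae_tendsto_velocity (hF : IsFlow Ω T b F) (hΩ : IsOpen Ω) (hT : 0 < T)
    (hb : AEStronglyMeasurable b (volume.restrict Ω)) :
    ∀ᵐ x ∂(volume.restrict Ω), Tendsto
      (fun n => (smallTime T n)⁻¹ • (F (smallTime T n) x - x)) atTop (𝓝 (b x)) := by
  set s := smallTime T with hs_def
  have hs0 := smallTime_pos hT
  have hsT := smallTime_le hT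
  have hS : MeasurableSet (Ioc 0 (T / 2)) := measurableSet_Ioc
  have hm0 : MapsTo (fun t : ℝ => t) (Ioc 0 (T / 2)) (Icc (-T) T) := fun t ht =>
    ⟨by linarith [ht.1], by linarith [ht.2]⟩
  have hmn : ∀ n, MapsTo (fun t : ℝ => t + s n) (Ioc 0 (T / 2)) (Icc (-T) T) := fun n t ht =>
    ⟨by linarith [ht.1, hs0 n], by linarith [ht.2, hsT n]⟩
  -- Lebesgue differentiation says nothing about the single time 0, so it is used at a.e. later time
  -- and transferred back by the group law. Times up to `T / 2` leave room for the increments `s n`.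
  have hae : ∀ᵐ x ∂(volume.restrict Ω), ∀ᵐ t ∂(volume.restrict (Ioc 0 (T / 2))),
      Tendsto (fun n => (s n)⁻¹ • (F (t + s n) x - F t x)) atTop (𝓝 (b (F t x))) := by
    filter_upwards [hF.ode] with x hx
    rw [ae_restrict_iff' hS]
    have hi := intervalIntegrable hT.le hx.1 (s := -T) (t := T) ⟨le_rfl, by linarith⟩
      ⟨by linarith, le_rfl⟩
    filter_upwards [hi.ae_hasDerivAt_integral] with t ht htS
    rw [uIcc_of_le (by linarith : -T ≤ T)] at ht
    have hd := ht (hm0 htS) 0 ⟨by linarith, hT.le⟩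
    refine ((hd.tendsto_slope_zero_right).comp (tendsto_smallTime_nhdsGT hT)).congr fun n => ?_
    simp only [comp_apply]
    rw [hx.2 _ (hmn n htS), hx.2 _ (hm0 htS), add_sub_add_left_eq_sub]
  have hnm : NullMeasurableSet {q : ℝ × Space d |
      Tendsto (fun n => (s n)⁻¹ • (F (q.1 + s n) q.2 - F q.1 q.2)) atTop (𝓝 (b (F q.1 q.2)))}
      ((volume.restrict (Ioc 0 (T / 2))).prod (volume.restrict Ω)) := by
    have h0 := hF.aemeasurable_prod hΩ hT.le hS continuous_id hm0
    have hn := fun n => hF.aemeasurable_prod hΩ hT.le hS (continuous_id.add_const (s n)) (hmn n)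
    have hB : AEMeasurable (fun q : ℝ × Space d => b (F q.1 q.2))
        ((volume.restrict (Ioc 0 (T / 2))).prod (volume.restrict Ω)) :=
      (hF.aestronglyMeasurable_comp_prod hΩ hT.le hS continuous_id hm0 hb).aemeasurable
    have hq : ∀ n, AEMeasurable
        (fun q : ℝ × Space d => (s n)⁻¹ • (F (q.1 + s n) q.2 - F q.1 q.2))
        ((volume.restrict (Ioc 0 (T / 2))).prod (volume.restrict Ω)) := fun n =>
      ((hn n).sub h0).const_smul (s n)⁻¹
    have hA : MeasurableSet {q : ℝ × Space d |
        Tendsto (fun n => (hq n).mk _ q) atTop (𝓝 (hB.mk _ q))} :=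
      measurableSet_tendsto_fun (fun n => (hq n).measurable_mk) hB.measurable_mk
    refine hA.nullMeasurableSet.congr ?_
    filter_upwards [ae_all_iff.2 fun n => (hq n).ae_eq_mk, hB.ae_eq_mk] with q h1 h2
    refine propext ?_
    change Tendsto _ _ _ ↔ Tendsto _ _ _
    simp only [← h1, ← h2]
  have hswap := NullMeasurableSet.ae_ae_swap (p := fun t x =>
    Tendsto (fun n => (s n)⁻¹ • (F (t + s n) x - F t x)) atTop (𝓝 (b (F t x)))) hnm hae
  have hne : (ae (volume.restrict (Ioc 0 (T / 2)))).NeBot := by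
    rw [ae_restrict_neBot, Real.volume_Ioc]
    simp [hT]
  -- At this fixed `t`, the quotient at `(t, x)` is the time-0 quotient at `F t x`; replacing `x` by
  -- `F (-t) x` then brings the limit back to `x`.
  obtain ⟨t, ht, htS⟩ := (hswap.and (ae_restrict_mem hS)).exists
  have hgrp : ∀ᵐ x ∂(volume.restrict Ω), ∀ n, F (t + s n) x = F (s n) (F t x) := by
    refine ae_all_iff.2 fun n => ?_
    have := hF.group (s n) ⟨by linarith [hs0 n], by linarith [hsT n]⟩ t (hm0 htS)
      (by rw [add_comm]; exact hmn n htS)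
    simpa only [add_comm] using this
  have hP : ∀ᵐ x ∂(volume.restrict Ω),
      Tendsto (fun n => (s n)⁻¹ • (F (s n) (F t x) - F t x)) atTop (𝓝 (b (F t x))) := by
    filter_upwards [ht, hgrp] with x hx hg
    simpa only [hg] using hx
  filter_upwards [hF.ae_comp hΩ (neg_mem_Icc (hm0 htS)) hP, hF.ae_comp_neg hT.le (hm0 htS)]
    with x hx hx'
  simpa only [hx'] using hx

end IsFlow

end EllamMmoc

/-! ### Test functions transported by the flow. -/

namespace EllamMmoc

open Filter Topology Function
open scoped NNReal

variable {d : ℕ} {Ω : Set (Space d)} {T : ℝ} {b : Space d → Space d}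
  {F : ℝ → Space d → Space d} {V : Set (Space d)} {L K : ℝ≥0} {h : Space d → ℝ}

/-- The function `h ∘ F_{-t}` on `F_t(V)`, extended by zero. -/
noncomputable def transported (F : ℝ → Space d → Space d) (V : Set (Space d)) (h : Space d → ℝ)
    (t : ℝ) : Space d → ℝ :=
  (F t '' V).indicator fun x => h (F (-t) x)

namespace IsRegularOn

theorem isCompact_image (hV : IsRegularOn Ω T F V L) (hc : HasCompactSupport h)
    (hs : tsupport h ⊆ V) {t : ℝ} (ht : t ∈ Icc (-T) T) : IsCompact (F t '' tsupport h) :=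
  hc.isCompact.image_of_continuousOn ((hV.lipschitz t ht).continuousOn.mono hs)

theorem transported_eq_zero (hV : IsRegularOn Ω T F V L) {t : ℝ} (ht : t ∈ Icc (-T) T)
    {x : Space d} (hx : x ∉ F t '' tsupport h) : transported F V h t x = 0 := by
  by_contra hne
  have hxV : x ∈ F t '' V := mem_of_indicator_ne_zero hne
  obtain ⟨y, hy, rfl⟩ := hxV
  refine hx (mem_image_of_mem _ (subset_tsupport _ ?_))
  rw [transported, indicator_of_mem (mem_image_of_mem _ hy), hV.leftInvOn t ht hy] at hne
  exact hne

theorem tsupport_transported_subset (hV : IsRegularOn Ω T F V L) (hc : HasCompactSupport h)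
    (hs : tsupport h ⊆ V) {t : ℝ} (ht : t ∈ Icc (-T) T) :
    tsupport (transported F V h t) ⊆ F t '' tsupport h :=
  closure_minimal (fun _ hx => by_contra fun hx' => hx (hV.transported_eq_zero ht hx'))
    (hV.isCompact_image hc hs ht).isClosed

theorem hasCompactSupport_transported (hV : IsRegularOn Ω T F V L) (hc : HasCompactSupport h)
    (hs : tsupport h ⊆ V) {t : ℝ} (ht : t ∈ Icc (-T) T) :
    HasCompactSupport (transported F V h t) :=
  (hV.isCompact_image hc hs ht).of_isClosed_subset (isClosed_tsupport _)
    (hV.tsupport_transported_subset hc hs ht)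

theorem lipschitzWith_transported (hV : IsRegularOn Ω T F V L) (hc : HasCompactSupport h)
    (hs : tsupport h ⊆ V) (hK : LipschitzWith K h) {t : ℝ} (ht : t ∈ Icc (-T) T) :
    LipschitzWith (K * L) (transported F V h t) := by
  refine LipschitzOnWith.lipschitzWith_of_eq_zero_off_compact (hV.isOpen_image t ht)
    (hV.isCompact_image hc hs ht) (image_mono hs) ?_ fun x hx => hV.transported_eq_zero ht hx
  have h1 : LipschitzOnWith (K * L) (h ∘ F (-t)) (F t '' V) :=
    hK.comp_lipschitzOnWith (hV.lipschitz_inv t ht)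
  intro x hx y hy
  simpa only [transported, indicator_of_mem hx, indicator_of_mem hy, comp_apply] using h1 hx hy

end IsRegularOn

namespace IsFlow

/-- If `h (F_{-t} x) ≠ 0`, then `F_{-t} x ∈ V`, so for a.e. such `x` the point `x = F_t (F_{-t} x)`
lies in `F_t(V)`. The extension by zero thus only removes uncontrolled values on a null set. -/
theorem ae_transported_eq (hF : IsFlow Ω T b F) (hT : 0 ≤ T)
    (hs : tsupport h ⊆ V) {t : ℝ} (ht : t ∈ Icc (-T) T) :
    ∀ᵐ x ∂(volume.restrict Ω), transported F V h t x = h (F (-t) x) := by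
  filter_upwards [hF.ae_comp_neg hT ht] with x hx
  by_cases hxV : x ∈ F t '' V
  · rw [transported, indicator_of_mem hxV]
  · rw [transported, indicator_of_notMem hxV]
    by_contra hne
    exact hxV ⟨F (-t) x, hs (subset_tsupport _ (Ne.symm hne)), hx⟩

/-- The derivative of `h` along the flow direction at `F_{-t}(x)` is that of the transported
function at `x`. -/
theorem ae_fderiv_transported (hF : IsFlow Ω T b F) (hΩ : IsOpen Ω) (hT : 0 < T)
    (hb : AEStronglyMeasurable b (volume.restrict Ω)) (hV : IsRegularOn Ω T F V L)
    (hh : ContDiff ℝ 1 h) (hc : HasCompactSupport h) (hs : tsupport h ⊆ V)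
    (hK : LipschitzWith K h) {t : ℝ} (ht : t ∈ Icc 0 T) :
    ∀ᵐ x ∂(volume.restrict Ω),
      fderiv ℝ h (F (-t) x) (b (F (-t) x)) = fderiv ℝ (transported F V h t) x (b x) := by
  have hT0 := hT.le
  have ht' : t ∈ Icc (-T) T := ⟨by linarith [ht.1], ht.2⟩
  have hnt := neg_mem_Icc ht'
  have hs0 := smallTime_pos hT
  have hsT := smallTime_le hT
  have hsI : ∀ n, smallTime T n ∈ Icc (-T) T := fun n =>
    ⟨by linarith [hs0 n], by linarith [hsT n]⟩
  have hsI' : ∀ n, smallTime T n + -t ∈ Icc (-T) T := fun n =>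
    ⟨by linarith [hs0 n, ht.2], by linarith [hsT n, ht.1]⟩
  have hvel := hF.ae_tendsto_velocity hΩ hT hb
  have hdiff : ∀ᵐ x ∂(volume.restrict Ω), DifferentiableAt ℝ (transported F V h t) x :=
    ae_restrict_of_ae (hV.lipschitzWith_transported hc hs hK ht').ae_differentiableAt
  have htr := hF.ae_transported_eq (V := V) hT0 hs ht'
  -- Commuting `F_s` with `F_{-t}` equates the difference quotients of the transported function at
  -- `x` and of `h` at `F_{-t} x`.
  have hall : ∀ᵐ x ∂(volume.restrict Ω), ∀ n,
      transported F V h t (F (smallTime T n) x) = h (F (smallTime T n) (F (-t) x)) := by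
    refine ae_all_iff.2 fun n => ?_
    filter_upwards [hF.ae_comp hΩ (hsI n) htr, hF.group _ (hsI n) _ hnt (hsI' n),
      hF.group _ hnt _ (hsI n) (by rw [add_comm]; exact hsI' n)] with x h1 h2 h3
    rw [h1, ← h2, ← h3, add_comm]
  have key : ∀ (k : Space d → ℝ) (y : Space d), DifferentiableAt ℝ k y →
      Tendsto (fun n => (smallTime T n)⁻¹ • (F (smallTime T n) y - y)) atTop (𝓝 (b y)) →
      Tendsto (fun n => (smallTime T n)⁻¹ • (k (F (smallTime T n) y) - k y)) atTop
        (𝓝 (fderiv ℝ k y (b y))) := by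
    intro k y hk hy
    have h0 : Tendsto (fun n => F (smallTime T n) y - y) atTop (𝓝 0) := by
      have := (tendsto_smallTime T).smul hy
      rw [zero_smul] at this
      refine this.congr fun n => smul_inv_smul₀ (hs0 n).ne' _
    have := hk.hasFDerivAt.hasFDerivWithinAt.lim (s := univ) h0
      (Eventually.of_forall fun _ => mem_univ _) hy
    simpa only [add_sub_cancel] using this
  filter_upwards [hvel, hF.ae_comp hΩ hnt hvel, hdiff, htr, hall] with x h1 h2 h3 h4 h5
  have l1 := key _ x h3 h1
  have l2 := key h (F (-t) x) (hh.differentiable one_ne_zero).differentiableAt h2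
  refine tendsto_nhds_unique l2 (l1.congr fun n => ?_)
  rw [h4, h5 n]

end IsFlow

end EllamMmoc

/-! ### Densities of weighted push-forwards. -/

namespace MeasureTheory

theorem MemLp.exists_ae_norm_le {B : Type*} [MeasurableSpace B] {μ : Measure B} {m : B → ℝ}
    (hm : MemLp m ∞ μ) : ∃ M : ℝ, ∀ᵐ x ∂μ, ‖m x‖ ≤ M := by
  refine ⟨(eLpNormEssSup m μ).toReal, ?_⟩
  have hfin : eLpNormEssSup m μ < ∞ := by simpa only [eLpNorm_exponent_top] using hm.2
  filter_upwards [ae_le_eLpNormEssSup (f := m) (μ := μ)] with x hx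
  simpa using ENNReal.toReal_mono hfin.ne hx

theorem Integrable.mul_memLp_top {B : Type*} [MeasurableSpace B] {μ : Measure B} {k m : B → ℝ}
    (hk : Integrable k μ) (hm : MemLp m ∞ μ) : Integrable (fun x => k x * m x) μ :=
  hk.mul_of_top_left hm

/-- A weighted push-forward by a nonsingular map is given by an integrable density, as far as
integrals of bounded functions are concerned. -/
theorem exists_density_comp {A B : Type*} [MeasurableSpace A] [MeasurableSpace B] {ν : Measure A}
    {μ : Measure B} [SigmaFinite μ] {Ψ : A → B} (hΨ : AEMeasurable Ψ ν)
    (hac : ν.map Ψ ≪ μ) {r : A → ℝ} (hr : Integrable r ν) :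
    ∃ k : B → ℝ, Integrable k μ ∧ ∀ m : B → ℝ, MemLp m ∞ μ →
      ∫ x, k x * m x ∂μ = ∫ a, r a * m (Ψ a) ∂ν := by
  have pos : ∀ r : A → ℝ, Integrable r ν → ∃ k : B → ℝ, Integrable k μ ∧ ∀ m : B → ℝ,
      MemLp m ∞ μ → ∫ x, k x * m x ∂μ = ∫ a, max (r a) 0 * m (Ψ a) ∂ν := by
    intro r hr
    -- `ENNReal.ofReal` keeps the positive part only; applying the construction to `r` and `-r`
    -- recovers both parts.
    let νr := ν.withDensity fun a => ENNReal.ofReal (r a)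
    have hfin : IsFiniteMeasure νr := isFiniteMeasure_withDensity_ofReal hr.2
    have hνr : νr ≪ ν := withDensity_absolutelyContinuous _ _
    have hΨr : AEMeasurable Ψ νr := hΨ.mono_ac hνr
    have hacr : νr.map Ψ ≪ μ := by
      refine Measure.AbsolutelyContinuous.mk fun s hs hs0 => ?_
      have := hac hs0
      rw [Measure.map_apply_of_aemeasurable hΨ hs] at this
      rw [Measure.map_apply_of_aemeasurable hΨr hs]
      exact hνr this
    refine ⟨fun x => ((νr.map Ψ).rnDeriv μ x).toReal, Measure.integrable_toReal_rnDeriv, ?_⟩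
    intro m hm
    have h1 := integral_rnDeriv_smul (f := m) hacr
    simp only [smul_eq_mul] at h1
    rw [h1, integral_map hΨr (hm.1.mono_ac hacr),
      integral_withDensity_eq_integral_toReal_smul₀ hr.1.aemeasurable.ennreal_ofReal
        (Filter.Eventually.of_forall fun _ => ENNReal.ofReal_lt_top)]
    simp only [smul_eq_mul, ENNReal.toReal_ofReal']
  obtain ⟨k₁, hk₁, h₁⟩ := pos r hr
  obtain ⟨k₂, hk₂, h₂⟩ := pos (fun a => - r a) hr.neg
  refine ⟨fun x => k₁ x - k₂ x, hk₁.sub hk₂, fun m hm => ?_⟩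
  have hmΨ : MemLp (fun a => m (Ψ a)) ∞ ν := by
    obtain ⟨M, hM⟩ := MemLp.exists_ae_norm_le hm
    exact memLp_top_of_bound ((hm.1.mono_ac hac).comp_aemeasurable hΨ) M
      (ae_of_ae_map hΨ (hac.ae_le hM))
  simp only [sub_mul]
  have hneg : Integrable (fun a => max (-r a) 0) ν := hr.neg.pos_part
  rw [integral_sub (hk₁.mul_memLp_top hm) (hk₂.mul_memLp_top hm), h₁ m hm, h₂ m hm,
    ← integral_sub (hr.pos_part.mul_memLp_top hmΨ) (hneg.mul_memLp_top hmΨ)]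
  refine integral_congr_ae (Filter.Eventually.of_forall fun a => ?_)
  simp only
  rw [← sub_mul, max_zero_sub_max_neg_zero_eq_self]

end MeasureTheory

/-! ### The transport identity. -/

namespace EllamMmoc

open Filter Topology Function
open scoped NNReal ContDiff

variable {d : ℕ} {Ω : Set (Space d)} {T : ℝ} {u : Space d → Space d} {φ g : Space d → ℝ}
  {F : ℝ → Space d → Space d} {V : Set (Space d)} {L K : ℝ≥0} {h : Space d → ℝ}

namespace IsFlow

theorem mapsTo_neg_Ioc {δ : ℝ} (hδ : δ ≤ T) (hT : 0 < T) :
    MapsTo (fun t : ℝ => -t) (Ioc 0 δ) (Icc (-T) T) := fun t ht =>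
  ⟨by linarith [ht.2], by linarith [ht.1]⟩

/-- The transport identity for smooth functions supported in a set where the flow is regular. -/
theorem transport_smooth (hF : IsFlow Ω T (fun x => (φ x)⁻¹ • u x) F) (hΩ : IsOpen Ω)
    (hT : 0 < T) (hφ : IntegrableOn φ Ω) (hφ0 : ∀ᵐ x ∂(volume.restrict Ω), φ x ≠ 0)
    (hu : IntegrableOn u Ω) (hg : IntegrableOn g Ω) (hdiv : IsWeakDivergence Ω u g)
    (hV : IsRegularOn Ω T F V L) (hh : ContDiff ℝ ∞ h) (hc : HasCompactSupport h)
    (hs : tsupport h ⊆ V) {δ : ℝ} (hδ : δ ∈ Ioc 0 T) :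
    (∫ x in Ω, φ x * h (F (-δ) x)) - ∫ x in Ω, φ x * h x
      = ∫ t in Ioc 0 δ, ∫ x in Ω, g x * h (F (-t) x) := by
  have hh1 : ContDiff ℝ 1 h := hh.of_le (by exact_mod_cast le_top)
  obtain ⟨K, hK⟩ := hh1.lipschitzWith_of_hasCompactSupport hc one_ne_zero
  obtain ⟨M, hM⟩ := hc.exists_bound_of_continuous hh.continuous
  have hb : AEStronglyMeasurable (fun x => (φ x)⁻¹ • u x) (volume.restrict Ω) :=
    hφ.1.aemeasurable.inv.aestronglyMeasurable.smul hu.1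
  have hσ : Continuous fun t : ℝ => -t := continuous_neg
  have hσS := mapsTo_neg_Ioc hδ.2 hT
  have hδT : -δ ∈ Icc (-T) T := ⟨by linarith [hδ.2], by linarith [hδ.1]⟩
  have hg0 : AEStronglyMeasurable (fun y => fderiv ℝ h y ((φ y)⁻¹ • u y))
      (volume.restrict Ω) :=
    (ContinuousLinearMap.apply ℝ ℝ).aestronglyMeasurable_comp₂ hb
      (measurable_fderiv ℝ h).aestronglyMeasurable
  let D : ℝ → Space d → ℝ := fun t x =>
    φ x * fderiv ℝ h (F (-t) x) ((φ (F (-t) x))⁻¹ • u (F (-t) x))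
  have hD : AEStronglyMeasurable (uncurry D)
      ((volume.restrict (Ioc 0 δ)).prod (volume.restrict Ω)) :=
    hφ.1.comp_snd.mul
      (hF.aestronglyMeasurable_comp_prod hΩ hT.le measurableSet_Ioc hσ hσS hg0)
  have htI : ∀ t ∈ Ioc 0 δ, t ∈ Icc (-T) T := fun t ht =>
    ⟨by linarith [ht.1], by linarith [ht.2, hδ.2]⟩
  -- Moving the derivative from `F (-t) x` to `x` lets the weight `φ x` cancel the factor `(φ x)⁻¹`
  -- in the velocity.
  have hDt : ∀ t ∈ Ioc 0 δ, ∀ᵐ x ∂(volume.restrict Ω),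
      D t x = fderiv ℝ (transported F V h t) x (u x) := by
    intro t ht
    filter_upwards [hF.ae_fderiv_transported hΩ hT hb hV hh1 hc hs hK
      ⟨ht.1.le, ht.2.trans hδ.2⟩, hφ0] with x h1 h2
    simp only [D]
    rw [h1, map_smul, smul_eq_mul, mul_inv_cancel_left₀ h2]
  have hDb : ∀ t ∈ Ioc 0 δ, ∀ᵐ x ∂(volume.restrict Ω), ‖D t x‖ ≤ (K * L : ℝ≥0) * ‖u x‖ := by
    intro t ht
    filter_upwards [hDt t ht] with x hx
    rw [hx]
    refine (ContinuousLinearMap.le_opNorm _ _).trans ?_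
    exact mul_le_mul_of_nonneg_right (norm_fderiv_le_of_lipschitz ℝ
      (hV.lipschitzWith_transported hc hs hK (htI t ht))) (norm_nonneg _)
  have hDi : Integrable (uncurry D) ((volume.restrict (Ioc 0 δ)).prod (volume.restrict Ω)) := by
    rw [integrable_prod_iff hD]
    have hmeas : ∀ᵐ t ∂(volume.restrict (Ioc 0 δ)),
        AEStronglyMeasurable (fun x => uncurry D (t, x)) (volume.restrict Ω) := hD.prodMk_left
    constructor
    · filter_upwards [hmeas, ae_restrict_mem measurableSet_Ioc] with t hm ht
      exact (hu.norm.const_mul _).mono' hm (hDb t ht)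
    · refine Integrable.of_bound (C := ∫ x in Ω, (K * L : ℝ≥0) * ‖u x‖)
        hD.norm.integral_prod_right' ?_
      filter_upwards [hmeas, ae_restrict_mem measurableSet_Ioc] with t hm ht
      rw [Real.norm_of_nonneg (integral_nonneg fun _ => norm_nonneg _)]
      exact integral_mono_ae ((hu.norm.const_mul _).mono' hm (hDb t ht)).norm
        (hu.norm.const_mul _) (hDb t ht)
  have hleft : ∀ᵐ x ∂(volume.restrict Ω),
      ∫ t in Ioc 0 δ, D t x = φ x * h x - φ x * h (F (-δ) x) := by
    filter_upwards [hF.ode, hF.ae_zero hT.le] with x hx hx0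
    have h0T : (0 : ℝ) ∈ Icc (-T) T := ⟨by linarith, hT.le⟩
    have hi := intervalIntegrable (F := F) (b := fun x => (φ x)⁻¹ • u x) hT.le hx.1 hδT h0T
    have hftc := integral_fderiv_comp_primitive hh1 hK hi (γ := fun s => F s x) (x := x)
      (c := 0) right_mem_uIcc (fun t ht => hx.2 t (by
        rw [uIcc_of_le (by linarith [hδ.1])] at ht
        exact ⟨by linarith [ht.1, hδ.2], by linarith [ht.2]⟩))
    simp only [D]
    rw [integral_const_mul, ← intervalIntegral.integral_of_le hδ.1.le,
      intervalIntegral.integral_comp_neg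
        (fun s => fderiv ℝ h (F s x) ((φ (F s x))⁻¹ • u (F s x))), neg_zero, hftc, hx0, mul_sub]
  have hright : ∀ t ∈ Ioc 0 δ, ∫ x in Ω, D t x = - ∫ x in Ω, g x * h (F (-t) x) := by
    intro t ht
    rw [integral_congr_ae (hDt t ht), hdiv.integral_fderiv_lipschitz hΩ hu hg
      (hV.lipschitzWith_transported hc hs hK (htI t ht))
      (hV.hasCompactSupport_transported hc hs (htI t ht))
      ((hV.tsupport_transported_subset hc hs (htI t ht)).trans (by
        rintro _ ⟨y, hy, rfl⟩
        exact hF.mapsTo t (htI t ht) (hV.subset (hs hy))))]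
    congr 1
    refine integral_congr_ae ?_
    filter_upwards [hF.ae_transported_eq (V := V) hT.le hs (htI t ht)] with x hx
    rw [hx]
  have hint : ∀ k : Space d → ℝ, AEStronglyMeasurable k (volume.restrict Ω) →
      (∀ x, ‖k x‖ ≤ M) → Integrable (fun x => φ x * k x) (volume.restrict Ω) := fun k hk hkM =>
    hφ.mul_bdd hk (Eventually.of_forall hkM)
  have hswap := integral_integral_swap hDi
  rw [integral_congr_ae hleft, setIntegral_congr_fun measurableSet_Ioc hright, integral_neg,
    integral_sub (hint h hh.continuous.aestronglyMeasurable hM)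
      (hint _ (hF.aestronglyMeasurable_comp hΩ hδT hh.continuous.aestronglyMeasurable)
        fun x => hM _)] at hswap
  linarith

theorem memLp_comp_prod {b : Space d → Space d} (hF : IsFlow Ω T b F) (hΩ : IsOpen Ω)
    (hT : 0 < T) {δ : ℝ} (hδ : δ ≤ T) {m : Space d → ℝ} (hm : MemLp m ∞ (volume.restrict Ω)) :
    MemLp (fun q : ℝ × Space d => m (F (-q.1) q.2)) ∞
      ((volume.restrict (Ioc 0 δ)).prod (volume.restrict Ω)) := by
  obtain ⟨M, hM⟩ := MemLp.exists_ae_norm_le hm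
  exact memLp_top_of_bound (hF.aestronglyMeasurable_comp_prod hΩ hT.le measurableSet_Ioc
    continuous_neg (mapsTo_neg_Ioc hδ hT) hm.1) M
    (hF.ae_comp_prod hΩ hT.le measurableSet_Ioc continuous_neg (mapsTo_neg_Ioc hδ hT) hM)

theorem memLp_comp {b : Space d → Space d} (hF : IsFlow Ω T b F) (hΩ : IsOpen Ω)
    {t : ℝ} (ht : t ∈ Icc (-T) T) {m : Space d → ℝ} (hm : MemLp m ∞ (volume.restrict Ω)) :
    MemLp (fun x => m (F t x)) ∞ (volume.restrict Ω) := by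
  obtain ⟨M, hM⟩ := MemLp.exists_ae_norm_le hm
  exact memLp_top_of_bound (hF.aestronglyMeasurable_comp hΩ ht hm.1) M (hF.ae_comp hΩ ht hM)

theorem integrable_comp_prod {b : Space d → Space d} (hF : IsFlow Ω T b F) (hΩ : IsOpen Ω)
    (hT : 0 < T) {δ : ℝ} (hδ : δ ≤ T) (hg : IntegrableOn g Ω) {m : Space d → ℝ}
    (hm : MemLp m ∞ (volume.restrict Ω)) :
    Integrable (fun q : ℝ × Space d => g q.2 * m (F (-q.1) q.2))
      ((volume.restrict (Ioc 0 δ)).prod (volume.restrict Ω)) :=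
  (Integrable.comp_snd hg _).mul_memLp_top (hF.memLp_comp_prod hΩ hT hδ hm)

/-- The transport identity for bounded functions. -/
theorem transport (hF : IsFlow Ω T (fun x => (φ x)⁻¹ • u x) F) (hΩ : IsOpen Ω)
    (hT : 0 < T) (hφ : IntegrableOn φ Ω) (hφ0 : ∀ᵐ x ∂(volume.restrict Ω), φ x ≠ 0)
    (hu : IntegrableOn u Ω) (hg : IntegrableOn g Ω) (hdiv : IsWeakDivergence Ω u g)
    {δ : ℝ} (hδ : δ ∈ Ioc 0 T) {m : Space d → ℝ} (hm : MemLp m ∞ (volume.restrict Ω)) :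
    (∫ x in Ω, φ x * m (F (-δ) x)) - ∫ x in Ω, φ x * m x
      = ∫ t in (0 : ℝ)..δ, ∫ x in Ω, m (F (-t) x) * g x := by
  have hδT : -δ ∈ Icc (-T) T := ⟨by linarith [hδ.2], by linarith [hδ.1]⟩
  obtain ⟨k₁, hk₁, h₁⟩ := exists_density_comp (hF.aemeasurable hΩ hδT)
    (hF.map_absolutelyContinuous hΩ hδT) hφ
  obtain ⟨k₂, hk₂, h₂⟩ := exists_density_comp
    (hF.aemeasurable_prod hΩ hT.le measurableSet_Ioc continuous_neg (mapsTo_neg_Ioc hδ.2 hT))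
    (hF.map_prod_absolutelyContinuous hΩ hT.le measurableSet_Ioc continuous_neg
      (mapsTo_neg_Ioc hδ.2 hT))
    (r := fun q => g q.2) (Integrable.comp_snd hg _)
  -- `k₁ - φ - k₂` is the density of the defect in the transport identity.
  have hsplit : ∀ k : Space d → ℝ, MemLp k ∞ (volume.restrict Ω) →
      ∫ x in Ω, (k₁ x - φ x - k₂ x) * k x = (∫ x in Ω, φ x * k (F (-δ) x))
        - (∫ x in Ω, φ x * k x) - ∫ t in Ioc 0 δ, ∫ x in Ω, g x * k (F (-t) x) := by
    intro k hk
    have e2 := h₂ k hk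
    rw [integral_prod _ (hF.integrable_comp_prod hΩ hT hδ.2 hg hk)] at e2
    simp only [sub_mul]
    have hsub : Integrable (fun x => k₁ x * k x - φ x * k x) (volume.restrict Ω) :=
      (hk₁.mul_memLp_top hk).sub (Integrable.mul_memLp_top hφ hk)
    rw [integral_sub hsub (hk₂.mul_memLp_top hk), integral_sub (hk₁.mul_memLp_top hk)
      (Integrable.mul_memLp_top hφ hk), h₁ k hk, e2]
  have hzero : ∀ᵐ x ∂(volume.restrict Ω), k₁ x - φ x - k₂ x = 0 := by
    have hnull : volume.restrict Ω
        {x | x ∈ regularSet Ω T F ∧ ¬ (k₁ x - φ x - k₂ x = 0)} = 0 := by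
      refine measure_null_of_locally_null _ fun x hx => ?_
      obtain ⟨V, ⟨L, hV⟩, hxV⟩ := hx.1
      refine ⟨V ∩ {x | x ∈ regularSet Ω T F ∧ ¬ (k₁ x - φ x - k₂ x = 0)},
        inter_mem (mem_nhdsWithin_of_mem_nhds (hV.isOpen.mem_nhds hxV)) self_mem_nhdsWithin, ?_⟩
      -- The fundamental lemma of the calculus of variations on each regular `V` suffices, since
      -- vanishing a.e. is a local property.
      have hloc := hV.isOpen.ae_eq_zero_of_integral_contDiff_smul_eq_zero
        (f := fun x => k₁ x - φ x - k₂ x) (μ := volume.restrict Ω)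
        (((hk₁.sub hφ).sub hk₂).locallyIntegrable.locallyIntegrableOn V) (by
          intro h hh hc hs
          have hmem : MemLp h ∞ (volume.restrict Ω) := by
            obtain ⟨M, hM⟩ := hc.exists_bound_of_continuous hh.continuous
            exact memLp_top_of_bound hh.continuous.aestronglyMeasurable M
              (Eventually.of_forall hM)
          have := hsplit h hmem
          rw [hF.transport_smooth hΩ hT hφ hφ0 hu hg hdiv hV hh hc hs hδ, sub_self] at this
          simpa only [smul_eq_mul, mul_comm] using this)
      refine measure_mono_null ?_ (ae_iff.1 hloc)
      rintro y ⟨hy, -, hy'⟩ hcon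
      exact hy' (hcon hy)
    have hnull' : ∀ᵐ x ∂(volume.restrict Ω), ¬ (x ∈ regularSet Ω T F ∧
        ¬ (k₁ x - φ x - k₂ x = 0)) := by simpa [ae_iff] using hnull
    filter_upwards [hnull', hF.ae_mem_regularSet] with x h1 h2
    exact not_not.1 fun h3 => h1 ⟨h2, h3⟩
  have hfin := hsplit m hm
  rw [integral_congr_ae (g := fun _ => (0 : ℝ))
    (by filter_upwards [hzero] with x hx; rw [hx, zero_mul]), integral_zero] at hfin
  rw [intervalIntegral.integral_of_le hδ.1.le]
  simp only [mul_comm _ (g _)]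
  linarith

end IsFlow

end EllamMmoc

/-! ### Time steps and boundedness of the sampled sources. -/

namespace EllamMmoc

open Filter Topology Function
open scoped NNReal

variable {d : ℕ} {Ω : Set (Space d)} {T : ℝ} {X : Type*} [AddCommGroup X] [Module ℝ X]

namespace GradientDiscretisation

theorem time_le_time (C : GradientDiscretisation Ω T X) {j k : ℕ} (hjk : j ≤ k) (hk : k ≤ C.N) :
    C.time j ≤ C.time k := by
  induction k, hjk using Nat.le_induction with
  | base => exact le_rfl
  | succ k _ ih => exact (ih (by omega)).trans (C.time_lt k (by omega)).le

theorem time_mem_Icc (C : GradientDiscretisation Ω T X) {k : ℕ} (hk : k ≤ C.N) :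
    C.time k ∈ Icc 0 T := by
  constructor
  · have := C.time_le_time (Nat.zero_le k) hk
    rwa [C.time_zero] at this
  · have := C.time_le_time hk le_rfl
    rwa [C.time_last] at this

theorem dt_mem_Ioc (C : GradientDiscretisation Ω T X) {n : ℕ} (hn : n < C.N) :
    C.dt n ∈ Ioc 0 T :=
  ⟨sub_pos.2 (C.time_lt n hn), by
    have h1 := (C.time_mem_Icc hn.le).1
    have h2 := (C.time_mem_Icc (Nat.succ_le_of_lt hn)).2
    unfold dt
    linarith⟩

end GradientDiscretisation

/-- A set of full measure in `(0, T)` is dense in `[0, T]` and the bound is a closed condition.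
Pointwise sampling needs it at individual times, endpoints included. -/
theorem abs_le_of_ae_abs_le {k : ℝ → ℝ} {T M : ℝ} (hT : 0 < T)
    (hk : ContinuousOn k (Icc 0 T)) (h : ∀ᵐ t ∂(volume.restrict (Ioo 0 T)), |k t| ≤ M) {t : ℝ}
    (ht : t ∈ Icc 0 T) : |k t| ≤ M := by
  have hd := Measure.dense_of_ae ((ae_restrict_iff' measurableSet_Ioo).1 h)
  have hcl : t ∈ closure (Ioo 0 T ∩ {t | t ∈ Ioo 0 T → |k t| ≤ M}) := by
    have := closure_minimal (hd.open_subset_closure_inter (isOpen_Ioo (a := 0) (b := T)))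
      isClosed_closure
    rw [closure_Ioo hT.ne] at this
    exact this ht
  have hsub : Ioo 0 T ∩ {t | t ∈ Ioo 0 T → |k t| ≤ M} ⊆ Icc 0 T :=
    inter_subset_left.trans Ioo_subset_Icc_self
  have hmaps : MapsTo k (Ioo 0 T ∩ {t | t ∈ Ioo 0 T → |k t| ≤ M}) {r | |r| ≤ M} :=
    fun s hs => hs.2 hs.1
  have hclosed : IsClosed {r : ℝ | |r| ≤ M} := isClosed_le continuous_abs continuous_const
  have := ((hk t ht).mono hsub).mem_closure hcl hmaps
  rwa [hclosed.closure_eq] at this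

/-- The Lipschitz bound gives `|f(s)| ≤ |f(0)| + Lf |s|`, with `s` a value of the essentially
bounded `Π c^(k)`. -/
theorem memLp_stepSource (hT : 0 < T) (hΩ : IsOpen Ω)
    {f : ℝ → Space d → ℝ → ℝ}
    (hf_meas : Measurable (fun p : ℝ × Space d × ℝ => f p.1 p.2.1 p.2.2))
    {Lf : ℝ≥0} (hf_lip : ∀ x ∈ Ω, ∀ t ∈ Icc 0 T, LipschitzWith Lf (fun s => f s x t))
    (hf_bdd : MemLp (fun p : Space d × ℝ => f 0 p.1 p.2) ∞ (volume.restrict (Ω ×ˢ Ioo 0 T)))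
    {rule : TimeRule}
    (hrule : rule = TimeRule.pointwise →
      ∀ᵐ x ∂(volume.restrict Ω), ∀ s, ContinuousOn (fun t => f s x t) (Icc 0 T))
    (C : GradientDiscretisation Ω T X) (c : ℕ → X) {k : ℕ} (hk : k ≤ C.N) (hN : 0 < C.N) :
    MemLp (stepSource C f rule c k) ∞ (volume.restrict Ω) := by
  have hs : Measurable (C.recon (c k) : Space d → ℝ) :=
    (Lp.stronglyMeasurable (C.recon (c k))).measurable
  obtain ⟨R, hR⟩ := MemLp.exists_ae_norm_le (Lp.memLp (C.recon (c k)))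
  obtain ⟨M, hM⟩ := MemLp.exists_ae_norm_le hf_bdd
  rw [Measure.volume_eq_prod, ← Measure.prod_restrict] at hM
  have hM' := Measure.ae_ae_of_ae_prod hM
  have hbound : ∀ x ∈ Ω, ∀ t ∈ Icc 0 T, ∀ s, |s| ≤ R → |f 0 x t| ≤ M →
      |f s x t| ≤ M + Lf * R := by
    intro x hx t ht s hsR h0
    have h1 := (hf_lip x hx t ht).dist_le_mul s 0
    rw [Real.dist_eq, Real.dist_eq, sub_zero] at h1
    have h2 : (Lf : ℝ) * |s| ≤ Lf * R := mul_le_mul_of_nonneg_left hsR Lf.2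
    have h3 := abs_sub_abs_le_abs_sub (f s x t) (f 0 x t)
    linarith
  cases rule with
  | pointwise =>
    refine memLp_top_of_bound (C := M + Lf * R) ?_ ?_
    · exact (hf_meas.comp (hs.prodMk (measurable_id.prodMk
        measurable_const))).aestronglyMeasurable
    · filter_upwards [hR, hM', hrule rfl, ae_restrict_mem hΩ.measurableSet] with x h1 h2 h3 h4
      exact hbound x h4 _ (C.time_mem_Icc hk) _ h1
        (abs_le_of_ae_abs_le hT (h3 0) h2 (C.time_mem_Icc hk))
  | average =>
    have hj : min k (C.N - 1) < C.N := by omega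
    generalize hjdef : min k (C.N - 1) = j at hj
    have hI : Ioo (C.time j) (C.time (j + 1)) ⊆ Ioo 0 T := Ioo_subset_Ioo
      (C.time_mem_Icc hj.le).1 (C.time_mem_Icc (Nat.succ_le_of_lt hj)).2
    have heq : stepSource C f TimeRule.average c k = fun x =>
        (volume.real (Ioo (C.time j) (C.time (j + 1))))⁻¹ *
          ∫ τ in Ioo (C.time j) (C.time (j + 1)), f (C.recon (c k) x) x τ := by
      ext x
      rw [stepSource, sampledSource, hjdef, setAverage_eq, smul_eq_mul]
    rw [heq]
    refine MemLp.const_mul ?_ _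
    refine memLp_top_of_bound
      (C := (M + Lf * R) * volume.real (Ioo (C.time j) (C.time (j + 1)))) ?_ ?_
    · have hm : Measurable (fun p : Space d × ℝ => f (C.recon (c k) p.1) p.1 p.2) :=
        hf_meas.comp ((hs.comp measurable_fst).prodMk (measurable_fst.prodMk measurable_snd))
      exact hm.stronglyMeasurable.integral_prod_right'.aestronglyMeasurable
    · filter_upwards [hR, hM', ae_restrict_mem hΩ.measurableSet] with x h1 h2 h4
      refine norm_setIntegral_le_of_norm_le_const_ae (by simp) ?_
      filter_upwards [ae_restrict_of_ae_restrict_of_subset hI h2,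
        ae_restrict_mem measurableSet_Ioo] with τ h5 h6
      exact hbound x h4 τ (Ioo_subset_Icc_self (hI h6)) _ h1 h5

theorem memLp_mmocPart (C : GradientDiscretisation Ω T X) {α : Space d → ℝ}
    (hα : MemLp α ∞ (volume.restrict Ω)) (c : ℕ → X) (k : ℕ) :
    MemLp (mmocPart C α c k) ∞ (volume.restrict Ω) :=
  (Lp.memLp (C.recon (c k))).mul (((memLp_top_const 1).sub hα))

end EllamMmoc

/-! ### The mass balance error. -/

theorem mainTheorem3
    {d : ℕ} (hd : 1 ≤ d)
    (Ω : Set (EllamMmoc.Space d)) (hΩ : IsOpen Ω) (hΩb : Bornology.IsBounded Ω)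
    (T : ℝ)
    -- porosity
    (φ : EllamMmoc.Space d → ℝ) (hφ : MemLp φ ∞ (volume.restrict Ω))
    (φmin : ℝ) (hφmin : 0 < φmin) (hφ_ge : ∀ᵐ x ∂(volume.restrict Ω), φmin ≤ φ x)
    -- source term and initial condition
    (f : ℝ → EllamMmoc.Space d → ℝ → ℝ)
    (hf_meas : Measurable (fun p : ℝ × EllamMmoc.Space d × ℝ => f p.1 p.2.1 p.2.2))
    (Lf : NNReal)
    (hf_lip : ∀ x ∈ Ω, ∀ t ∈ Icc 0 T, LipschitzWith Lf (fun s => f s x t))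
    (hf_bdd : MemLp (fun p : EllamMmoc.Space d × ℝ => f 0 p.1 p.2) ∞
      (volume.restrict (Ω ×ˢ Ioo 0 T)))
    (rule : EllamMmoc.TimeRule)
    (hrule : rule = EllamMmoc.TimeRule.pointwise →
      ∀ᵐ x ∂(volume.restrict Ω), ∀ s, ContinuousOn (fun t => f s x t) (Icc 0 T))
    (cini : EllamMmoc.LInf Ω)
    -- gradient discretisation, for which the function 1 is a reconstruction
    {X : Type*} [AddCommGroup X] [Module ℝ X] [FiniteDimensional ℝ X]
    (C : EllamMmoc.GradientDiscretisation Ω T X)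
    (hone : ∃ z₁ : X, ∀ᵐ x ∂(volume.restrict Ω), C.recon z₁ x = 1)
    -- approximate velocities, their divergences and their flows
    (u : ℕ → EllamMmoc.Space d → EllamMmoc.Space d) (divu : ℕ → EllamMmoc.Space d → ℝ)
    (F : ℕ → ℝ → EllamMmoc.Space d → EllamMmoc.Space d)
    (hu : ∀ n < C.N, MemLp (u (n + 1)) 2 (volume.restrict Ω))
    (hdiv : ∀ n < C.N, EllamMmoc.IsWeakDivergence Ω (u (n + 1)) (divu (n + 1)))
    (hdiv_bdd : ∀ n < C.N, MemLp (divu (n + 1)) ∞ (volume.restrict Ω))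
    (hF : ∀ n < C.N,
      EllamMmoc.IsFlow Ω T (fun x => (φ x)⁻¹ • u (n + 1) x) (F (n + 1)))
    -- splitting function and quadrature weight
    (α : EllamMmoc.Space d → ℝ) (hα : MemLp α ∞ (volume.restrict Ω))
    (w : ℝ) (hw : w ∈ Icc (0 : ℝ) 1)
    -- solution of the scheme
    (c : ℕ → X)
    (hc : EllamMmoc.IsEllamMmocSolution C φ f rule cini divu F α w c)
    (n : ℕ) (hn : n < C.N) :
    EllamMmoc.massBalanceError C φ f rule w c n
        = |(∫ t in (0 : ℝ)..C.dt n, ∫ x in Ω,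
              EllamMmoc.mmocPart C α c n (F (n + 1) (-t) x) * divu (n + 1) x)
            - C.dt n * ∫ x in Ω, (1 - α x) * divu (n + 1) x *
                (w * C.recon (c n) x + (1 - w) * C.recon (c (n + 1)) x)|
    ∧ EllamMmoc.massBalanceError C φ f rule w c n
        ≤ w * |∫ t in (0 : ℝ)..C.dt n, ∫ x in Ω,
              (EllamMmoc.mmocPart C α c n (F (n + 1) (-t) x)
                - EllamMmoc.mmocPart C α c n x) * divu (n + 1) x|
          + (1 - w) * |∫ t in (0 : ℝ)..C.dt n, ∫ x in Ω,
              (EllamMmoc.mmocPart C α c n (F (n + 1) (-t) x)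
                - EllamMmoc.mmocPart C α c (n + 1) x) * divu (n + 1) x|
    ∧ (∀ κ : ℝ,
        (∀ᵐ x ∂(volume.restrict Ω),
          x ∈ EllamMmoc.traceBack Ω (divu (n + 1)) (F (n + 1)) (C.dt n) →
            EllamMmoc.mmocPart C α c n x = κ ∧ EllamMmoc.mmocPart C α c (n + 1) x = κ) →
        EllamMmoc.massBalanceError C φ f rule w c n = 0)
    ∧ ((∀ᵐ x ∂(volume.restrict Ω),
          x ∈ EllamMmoc.traceBack Ω (divu (n + 1)) (F (n + 1)) (C.dt n) → α x = 1) →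
        EllamMmoc.massBalanceError C φ f rule w c n = 0) := by
  set μ := volume.restrict Ω with hμ
  have : IsFiniteMeasure μ := isFiniteMeasure_restrict.2 hΩb.measure_lt_top.ne
  have hδ := C.dt_mem_Ioc hn
  -- Positivity of `T` comes from the existence of a time step.
  have hT : 0 < T := hδ.1.trans_le hδ.2
  have hFn := hF n hn
  set δ := C.dt n with hδdef
  set G := F (n + 1) with hG
  set g := divu (n + 1) with hgdef
  have hδT : δ ∈ Icc (-T) T := ⟨by linarith [hδ.1], hδ.2⟩
  have hδT' := EllamMmoc.IsFlow.neg_mem_Icc hδT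
  have hφi : Integrable φ μ := hφ.integrable le_top
  have hφ0 : ∀ᵐ x ∂μ, φ x ≠ 0 := by
    filter_upwards [hφ_ge] with x hx using (hφmin.trans_le hx).ne'
  have hui : Integrable (u (n + 1)) μ := (hu n hn).integrable one_le_two
  have hgi : Integrable g μ := (hdiv_bdd n hn).integrable le_top
  have hrec : ∀ k, MemLp (C.recon (c k) : EllamMmoc.Space d → ℝ) ∞ μ := fun k => Lp.memLp _
  have hm : ∀ k, MemLp (EllamMmoc.mmocPart C α c k) ∞ μ := EllamMmoc.memLp_mmocPart C hα c
  have hsrc : ∀ k ≤ C.N, MemLp (EllamMmoc.stepSource C f rule c k) ∞ μ := fun k hk =>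
    EllamMmoc.memLp_stepSource hT hΩ hf_meas hf_lip hf_bdd hrule C c hk (by omega)
  have hS : Integrable (fun x => w * EllamMmoc.stepSource C f rule c n x
      + (1 - w) * EllamMmoc.stepSource C f rule c (n + 1) x) μ :=
    (((hsrc n hn.le).integrable le_top).const_mul w).add
      (((hsrc (n + 1) hn).integrable le_top).const_mul (1 - w))
  have hα1 : MemLp (fun x => 1 - α x) ∞ μ := (memLp_top_const 1).sub hα
  -- the scheme tested with the unit function
  have hbal : (∫ x in Ω, φ x * C.recon (c (n + 1)) x) - (∫ x in Ω, φ x * C.recon (c n) x)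
      - δ * (∫ x in Ω, (w * EllamMmoc.stepSource C f rule c n x
          + (1 - w) * EllamMmoc.stepSource C f rule c (n + 1) x))
      = (∫ t in (0 : ℝ)..δ, ∫ x in Ω, EllamMmoc.mmocPart C α c n (G (-t) x) * g x)
        - δ * ∫ x in Ω, (1 - α x) * g x *
            (w * C.recon (c n) x + (1 - w) * C.recon (c (n + 1)) x) := by
    obtain ⟨z, hz⟩ := hone
    have hzF : ∀ᵐ x ∂μ, C.recon z (G δ x) = 1 := hFn.ae_comp hΩ hδT hz
    have hstep := hc.step n hn z
    have htr := hFn.transport hΩ hT hφi hφ0 hui hgi (hdiv n hn) hδ (hm n)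
    rw [← hδdef, ← hG, ← hgdef] at hstep
    have e1 : ∫ x in Ω, φ x * C.recon (c (n + 1)) x * C.recon z x
        = ∫ x in Ω, φ x * C.recon (c (n + 1)) x :=
      integral_congr_ae (by filter_upwards [hz] with x hx; rw [hx, mul_one])
    -- Writing `α = 1 - (1 - α)` produces the old mass and the term `∫ φ m` that `htr` pairs with
    -- `e3`.
    have e2 : ∫ x in Ω, φ x * α x * C.recon (c n) x * C.recon z (G δ x)
        = (∫ x in Ω, φ x * C.recon (c n) x)
          - ∫ x in Ω, φ x * EllamMmoc.mmocPart C α c n x := by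
      rw [← integral_sub (hφi.mul_memLp_top (hrec n)) (hφi.mul_memLp_top (hm n))]
      refine integral_congr_ae ?_
      filter_upwards [hzF] with x hx
      rw [hx, EllamMmoc.mmocPart]
      ring
    have e3 : ∫ x in Ω, φ x * ((1 - α (G (-δ) x)) * C.recon (c n) (G (-δ) x)) * C.recon z x
        = ∫ x in Ω, φ x * EllamMmoc.mmocPart C α c n (G (-δ) x) :=
      integral_congr_ae (by
        filter_upwards [hz] with x hx
        rw [hx, mul_one, EllamMmoc.mmocPart])
    have e4 : ∫ x in Ω, α x * (w * EllamMmoc.stepSource C f rule c n x * C.recon z (G δ x)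
          + (1 - w) * EllamMmoc.stepSource C f rule c (n + 1) x * C.recon z x)
        = (∫ x in Ω, (w * EllamMmoc.stepSource C f rule c n x
            + (1 - w) * EllamMmoc.stepSource C f rule c (n + 1) x))
          - ∫ x in Ω, (w * EllamMmoc.stepSource C f rule c n x
            + (1 - w) * EllamMmoc.stepSource C f rule c (n + 1) x) * (1 - α x) := by
      rw [← integral_sub hS (hS.mul_memLp_top hα1)]
      refine integral_congr_ae ?_
      filter_upwards [hz, hzF] with x hx hx'
      rw [hx, hx']
      ring
    have e5 : ∫ x in Ω, (1 - α x) * (w * EllamMmoc.stepSource C f rule c n x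
          + (1 - w) * EllamMmoc.stepSource C f rule c (n + 1) x) * C.recon z x
        = ∫ x in Ω, (w * EllamMmoc.stepSource C f rule c n x
            + (1 - w) * EllamMmoc.stepSource C f rule c (n + 1) x) * (1 - α x) :=
      integral_congr_ae (by
        filter_upwards [hz] with x hx
        rw [hx, mul_one, mul_comm])
    have e6 : ∫ x in Ω, (1 - α x) * g x * (w * C.recon (c n) x
          + (1 - w) * C.recon (c (n + 1)) x) * C.recon z x
        = ∫ x in Ω, (1 - α x) * g x * (w * C.recon (c n) x
          + (1 - w) * C.recon (c (n + 1)) x) :=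
      integral_congr_ae (by filter_upwards [hz] with x hx; rw [hx, mul_one])
    rw [e1, e2, e3, e4, e5, e6] at hstep
    linear_combination hstep + htr
  have heq : EllamMmoc.massBalanceError C φ f rule w c n
      = |(∫ t in (0 : ℝ)..δ, ∫ x in Ω, EllamMmoc.mmocPart C α c n (G (-t) x) * g x)
        - δ * ∫ x in Ω, (1 - α x) * g x *
            (w * C.recon (c n) x + (1 - w) * C.recon (c (n + 1)) x)| := by
    rw [← hbal, EllamMmoc.massBalanceError]
  have hmg : ∀ k, Integrable (fun x => EllamMmoc.mmocPart C α c k x * g x) μ := fun k => by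
    simpa only [mul_comm] using hgi.mul_memLp_top (hm k)
  have hD : ∫ x in Ω, (1 - α x) * g x * (w * C.recon (c n) x
        + (1 - w) * C.recon (c (n + 1)) x)
      = w * (∫ x in Ω, EllamMmoc.mmocPart C α c n x * g x)
        + (1 - w) * ∫ x in Ω, EllamMmoc.mmocPart C α c (n + 1) x * g x := by
    rw [← integral_const_mul, ← integral_const_mul,
      ← integral_add ((hmg n).const_mul w) ((hmg (n + 1)).const_mul (1 - w))]
    refine integral_congr_ae (Filter.Eventually.of_forall fun x => ?_)
    simp only [EllamMmoc.mmocPart]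
    ring
  have hint := hFn.integrable_comp_prod hΩ hT hδ.2 hgi (hm n)
  have hJ : ∀ k, ∫ t in (0 : ℝ)..δ, ∫ x in Ω, (EllamMmoc.mmocPart C α c n (G (-t) x)
        - EllamMmoc.mmocPart C α c k x) * g x
      = (∫ t in (0 : ℝ)..δ, ∫ x in Ω, EllamMmoc.mmocPart C α c n (G (-t) x) * g x)
        - δ * ∫ x in Ω, EllamMmoc.mmocPart C α c k x * g x := by
    intro k
    have hti : IntervalIntegrable
        (fun t => ∫ x in Ω, EllamMmoc.mmocPart C α c n (G (-t) x) * g x) volume 0 δ := by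
      rw [intervalIntegrable_iff_integrableOn_Ioc_of_le hδ.1.le]
      refine hint.integral_prod_left.congr (Filter.Eventually.of_forall fun t => ?_)
      simp only [mul_comm]
    have hconst : δ * (∫ x in Ω, EllamMmoc.mmocPart C α c k x * g x)
        = ∫ _ in (0 : ℝ)..δ, ∫ x in Ω, EllamMmoc.mmocPart C α c k x * g x := by
      rw [intervalIntegral.integral_const, sub_zero, smul_eq_mul]
    rw [hconst, ← intervalIntegral.integral_sub hti intervalIntegrable_const]
    refine intervalIntegral.integral_congr_ae (Filter.Eventually.of_forall fun t ht => ?_)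
    rw [uIoc_of_le hδ.1.le] at ht
    have hmt := hFn.memLp_comp hΩ (EllamMmoc.IsFlow.mapsTo_neg_Ioc hδ.2 hT ht) (hm n)
    have hmti : Integrable (fun x => EllamMmoc.mmocPart C α c n (G (-t) x) * g x) μ := by
      simpa only [mul_comm] using hgi.mul_memLp_top hmt
    simp only [sub_mul]
    exact integral_sub hmti (hmg k)
  have hle : EllamMmoc.massBalanceError C φ f rule w c n
      ≤ w * |∫ t in (0 : ℝ)..δ, ∫ x in Ω, (EllamMmoc.mmocPart C α c n (G (-t) x)
              - EllamMmoc.mmocPart C α c n x) * g x|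
        + (1 - w) * |∫ t in (0 : ℝ)..δ, ∫ x in Ω, (EllamMmoc.mmocPart C α c n (G (-t) x)
              - EllamMmoc.mmocPart C α c (n + 1) x) * g x| := by
    rw [heq, hD, hJ n, hJ (n + 1)]
    generalize (∫ t in (0 : ℝ)..δ, ∫ x in Ω, EllamMmoc.mmocPart C α c n (G (-t) x) * g x) = J
    generalize (∫ x in Ω, EllamMmoc.mmocPart C α c n x * g x) = a
    generalize (∫ x in Ω, EllamMmoc.mmocPart C α c (n + 1) x * g x) = a'
    calc |J - δ * (w * a + (1 - w) * a')|
        = |w * (J - δ * a) + (1 - w) * (J - δ * a')| := by ring_nf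
      _ ≤ |w * (J - δ * a)| + |(1 - w) * (J - δ * a')| := abs_add_le _ _
      _ = w * |J - δ * a| + (1 - w) * |J - δ * a'| := by
        rw [abs_mul, abs_mul, abs_of_nonneg hw.1, abs_of_nonneg (sub_nonneg.2 hw.2)]
  have hconst : ∀ κ : ℝ, (∀ᵐ x ∂μ, x ∈ EllamMmoc.traceBack Ω g G δ →
      EllamMmoc.mmocPart C α c n x = κ ∧ EllamMmoc.mmocPart C α c (n + 1) x = κ) →
      EllamMmoc.massBalanceError C φ f rule w c n = 0 := by
    intro κ hκ
    have hzero : ∀ k, (∀ᵐ x ∂μ, x ∈ EllamMmoc.traceBack Ω g G δ →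
        EllamMmoc.mmocPart C α c n x = κ ∧ EllamMmoc.mmocPart C α c k x = κ) →
        ∫ t in (0 : ℝ)..δ, ∫ x in Ω, (EllamMmoc.mmocPart C α c n (G (-t) x)
          - EllamMmoc.mmocPart C α c k x) * g x = 0 := by
      intro k hk
      refine intervalIntegral.integral_zero_ae (Filter.Eventually.of_forall fun t ht => ?_)
      rw [uIoc_of_le hδ.1.le] at ht
      rw [← integral_zero (EllamMmoc.Space d) ℝ (μ := μ)]
      refine integral_congr_ae ?_
      filter_upwards [hFn.ae_comp hΩ (EllamMmoc.IsFlow.mapsTo_neg_Ioc hδ.2 hT ht) hk, hk,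
        hFn.ae_zero hT.le, ae_restrict_mem hΩ.measurableSet] with x h1 h2 h3 h4
      by_cases hgx : g x = 0
      · rw [hgx, mul_zero]
      -- Time `-t` places `G (-t) x` in the trace-back, and time 0 places `x` itself there, up to
      -- the null set where `G 0 x ≠ x`.
      · have hmem : ∀ s ∈ Icc (-δ) 0, G s x ∈ EllamMmoc.traceBack Ω g G δ := fun s hs =>
          mem_biUnion hs (mem_image_of_mem _ ⟨h4, hgx⟩)
        have m1 := (h1 (hmem (-t) ⟨neg_le_neg ht.2, by linarith [ht.1]⟩)).1
        have m2 := (h2 (h3 ▸ hmem 0 ⟨by linarith [hδ.1], le_rfl⟩)).2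
        rw [m1, m2, sub_self, zero_mul]
    refine le_antisymm ?_ (abs_nonneg _)
    refine hle.trans ?_
    rw [hzero n (by filter_upwards [hκ] with x hx h using ⟨(hx h).1, (hx h).1⟩),
      hzero (n + 1) hκ]
    simp
  refine ⟨heq, hle, hconst, fun hα1 => hconst 0 ?_⟩
  filter_upwards [hα1] with x hx h
  simp [EllamMmoc.mmocPart, hx h]
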